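/- **Setting.** Let $p\ge 1$, $k\ge 2$, and let $z_t=(y_t,x_t^{\mathsf T})^{\mathsf T}\in\mathbb R\times\mathbb R^{p-1}$ satisfy, for $t\ge 1$, $$z_t=c+\sum_{i=1}^k\big(\phi_i^+y_{t-i}^+ +\phi_i^-y_{t-i}^-+\Phi_i^x x_{t-i}\big)+u_t,\qquad y_t^+=\max\{y_t,0\},\quad y_t^-=\min\{y_t,0\},$$ with $\phi_i^\pm\in\mathbb R^p$, $\Phi_i^x\in\mathbb R^{p\times(p-1)}$ and random initial values $z_{-k+1},\dots,z_0$, which may depend on the sample size $n$ (a model with $k=1$ is treated as one with $k=2$ and $\phi_2^\pm=0$, $\Phi_2^x=0$). Put $\Phi_i^\pm=[\phi_i^\pm,\Phi_i^x]$, $\Phi^\pm(\lambda)=I_p-\sum_{i=1}^k\Phi_i^\pm\lambda^i$, $\Pi^\pm=-\Phi^\pm(1)=[\pi^\pm,\Pi^x]$, $\Gamma_i^\pm=-\sum_{j=i+1}^k\Phi_j^\pm$ and $\Gamma^\pm(1)=I_p-\sum_{i=1}^{k-1}\Gamma_i^\pm$. Let $D[0,1]$ be the space of cadlag functions on $[0,1]$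 with the uniform topology, and $\Delta z_t=z_t-z_{t-1}$. A sequence $w_t$ (possibly depending on $n$) is $I^*(0)$ if $n^{-1/2}\max_{1\le t\le n}\|w_t\|\to 0$ in probability as $n\to\infty$. **Assumptions.** 1. (Errors.) For some $\delta_u>0$, $\sup_{t\ge 1}\mathbb E\|u_t\|^{2+\delta_u}<\infty$, and $n^{-1/2}\sum_{t=1}^{\lfloor n\lambda\rfloor}u_t$ converges weakly on $D[0,1]$ to a $p$-dimensional Brownian motion $U(\lambda)$ with positive definite variance $\Sigma$. 2. (Unit roots.) $\det\Phi^\pm(\lambda)$ has $q^\pm$ roots at $1$ (with multiplicity) and all its other complex roots outside the closed unit disc; $\operatorname{rank}\Pi^\pm=p-q^\pm$; and $c$ lies in the column spaces of $\Pi^+$ and of $\Pi^-$. 3. (Ranks.) $\operatorname{rank}\Pi^+=\operatorname{rank}\Pi^x=r$ and $\operatorname{rank}\Pi^-=r+1$. Write $\Pi^+=\alpha^+\beta^{+\mathsf T}$ with $\alpha^+,\beta^+\in\mathbb R^{p\times r}$ of rank $r$; let $\alpha^+_\perp,\beta^+_\perp\in\mathbb R^{p\times(p-r)}$ have rank $p-r$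 and satisfy $\alpha_\perp^{+\mathsf T}\alpha^+=0$, $\beta_\perp^{+\mathsf T}\beta^+=0$; and put $P_{\beta_\perp^+}=\beta_\perp^+[\alpha_\perp^{+\mathsf T}\Gamma^+(1)\beta_\perp^+]^{-1}\alpha_\perp^{+\mathsf T}$. 4. (Joint spectral radius.) $\rho_{\mathrm{JSR}}(\{F_0,F_1\})<1$, where $\rho_{\mathrm{JSR}}(\mathcal A)=\limsup_{t\to\infty}\sup\{\rho(B)^{1/t}: B \text{ a product of } t \text{ elements of }\mathcal A\}$, with $\rho$ the spectral radius, and $$F_\delta=\begin{bmatrix}I+\boldsymbol\beta^{\mathsf T}\boldsymbol\alpha & \boldsymbol\beta_{1:p}^{\mathsf T}(\phi_1^--\phi_1^+)\delta & \boldsymbol\beta_{1:p}^{\mathsf T}(\varphi^--\varphi^+)\\ e_1^{\mathsf T}\boldsymbol\alpha & [1+e_1^{\mathsf T}(\phi_1^--\phi_1^+)]\delta & e_1^{\mathsf T}(\varphi^--\varphi^+)\\ 0&\delta&0\\ 0&0&[I_{k-2},0]\end{bmatrix},\qquad \varphi^\pm=[\phi_2^\pm,\dots,\phi_k^\pm].$$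 Here $\boldsymbol\alpha,\boldsymbol\beta\in\mathbb R^{kp\times[r+p(k-1)]}$: the first block row of $\boldsymbol\alpha$ is $[\alpha^+,\Gamma_1^+,\dots,\Gamma_{k-1}^+]$ and its other rows are $[0_{p(k-1)\times r},I_{p(k-1)}]$; the first block row of $\boldsymbol\beta^{\mathsf T}$ is $[\beta^{+\mathsf T},0,\dots,0]$ and its $(m+1)$-th block row, $1\le m\le k-1$, has $I_p$ in block column $m$, $-I_p$ in block column $m+1$ and zeros elsewhere; $\boldsymbol\beta_{1:p}$ denotes the first $p$ rows of $\boldsymbol\beta$. 5. $\kappa_1<0$, where $\kappa_1$ is the first element of $\kappa=P_{\beta^+_\perp}\pi^-$. 6. (Initial values.) $\beta^{+\mathsf T}z_t$ and $y_t^-$ for $-k+1\le t\le 0$, and $\Delta z_t$ for $-k+2\le t\le 0$, have uniformly bounded moments of order $2+\delta_u$; and $n^{-1/2}z_0\to\mathcal Z_0=(\mathcal Y_0,\mathcal X_0)$ in probability, where $\mathcal Z_0$ is non-random and $\pi^+[\mathcal Y_0]_++\pi^-[\mathcal Y_0]_-+\Pi^x\mathcal X_0=0$, with $[a]_+=\max\{a,0\}$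 and $[a]_-=\min\{a,0\}$. **Theorem.** Let $U_0(\lambda)=\Gamma^+(1)\mathcal Z_0+U(\lambda)$. Then: (i) $\beta^{+\mathsf T}z_t$, $\Delta z_t$ and $y_t^-$ are all $I^*(0)$; (ii) on $D[0,1]$, $$n^{-1/2}\begin{bmatrix}y_{\lfloor n\lambda\rfloor}\\x_{\lfloor n\lambda\rfloor}\end{bmatrix}\Rightarrow\begin{bmatrix}Y(\lambda)\\X(\lambda)\end{bmatrix}=P_{\beta_\perp^+}U_0(\lambda)+\kappa_1^{-1}\kappa\sup_{\lambda'\le\lambda}\big[-e_1^{\mathsf T}P_{\beta_\perp^+}U_0(\lambda')\big]_+ .$$ In particular $Y(\lambda)=e_1^{\mathsf T}P_{\beta_\perp^+}U_0(\lambda)+\sup_{\lambda'\le\lambda}[-e_1^{\mathsf T}P_{\beta_\perp^+}U_0(\lambda')]_+$, which is a Brownian motion (of nonzero variance, initialised at $\mathcal Y_0\ge 0$) regulated from below at zero. -/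

import Mathlib

open MeasureTheory ProbabilityTheory Filter Topology
open scoped NNReal ENNReal unitInterval Matrix

namespace RegCoint

noncomputable section

/-! ### The space `D[0,1]` and weak convergence of processes -/

/-- A function on `[0,1]` is cadlag: right-continuous, with left limits. -/
def IsCadlag {E : Type*} [TopologicalSpace E] (f : I → E) : Prop :=
  ∀ t : I, ContinuousWithinAt f (Set.Ici t) t ∧ ∃ l, Tendsto f (𝓝[<] t) (𝓝 l)

/-- The space of cadlag functions `[0,1] → E`. -/
def CadlagSpace (E : Type*) [EMetricSpace E] : Type _ :=
  {f : UniformFun I E // IsCadlag (UniformFun.toFun f)}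

/-- The uniform topology on the cadlag functions, given by the distance
`sup_t edist (f t) (g t)`. -/
instance (E : Type*) [EMetricSpace E] : EMetricSpace (CadlagSpace E) :=
  inferInstanceAs (EMetricSpace {f : UniformFun I E // IsCadlag (UniformFun.toFun f)})

instance (E : Type*) [EMetricSpace E] : MeasurableSpace (CadlagSpace E) := borel _

instance (E : Type*) [EMetricSpace E] : BorelSpace (CadlagSpace E) := ⟨rfl⟩

/-- The value of a cadlag function at a time. -/
def CadlagSpace.path {E : Type*} [EMetricSpace E] (f : CadlagSpace E) : I → E :=
  UniformFun.toFun f.1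

/-- Weak convergence on `D[0,1]` (uniform topology) of the processes `X n` to the process `Z`:
their paths are almost surely those of random elements of `D[0,1]` whose laws converge weakly. -/
def ConvergesWeaklyOnD {Ω Ω' E : Type*} [MeasurableSpace Ω] [MeasurableSpace Ω'] [EMetricSpace E]
    (P : Measure Ω) [IsProbabilityMeasure P] (P' : Measure Ω') [IsProbabilityMeasure P']
    (X : ℕ → I → Ω → E) (Z : I → Ω' → E) : Prop :=
  ∃ (X' : ℕ → Ω → CadlagSpace E) (Z' : Ω' → CadlagSpace E),
    (∀ n, ∀ᵐ ω ∂P, ∀ t, (X' n ω).path t = X n t ω) ∧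
    (∀ᵐ ω ∂P', ∀ t, (Z' ω).path t = Z t ω) ∧
    TendstoInDistribution X' atTop Z' (fun _ => P) P'

/-! ### Brownian motions on `[0,1]` -/

/-- `W` is a Brownian motion on `[0,1]` in `ℝ^ι`, started at `0`, with variance matrix `S`. -/
structure IsBrownianMotion {Ω ι : Type*} [MeasurableSpace Ω] [Fintype ι] [DecidableEq ι]
    (W : I → Ω → EuclideanSpace ℝ ι) (S : Matrix ι ι ℝ) (P : Measure Ω) : Prop where
  start : ∀ᵐ ω ∂P, W 0 ω = 0
  indep : HasIndepIncrements W P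
  law : ∀ s t : I, s ≤ t →
    HasLaw (fun ω => W t ω - W s ω) (multivariateGaussian 0 (((t : ℝ) - s) • S)) P
  cont : ∀ᵐ ω ∂P, Continuous (fun t => W t ω)

/-- `W` is a scalar Brownian motion on `[0,1]`, started at `w₀`, with variance `v`. -/
structure IsScalarBrownianMotion {Ω : Type*} [MeasurableSpace Ω]
    (W : I → Ω → ℝ) (w₀ : ℝ) (v : ℝ≥0) (P : Measure Ω) : Prop where
  start : ∀ᵐ ω ∂P, W 0 ω = w₀
  indep : HasIndepIncrements W P
  law : ∀ s t : I, s ≤ t →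
    HasLaw (fun ω => W t ω - W s ω) (gaussianReal 0 (((t : ℝ) - s).toNNReal * v)) P
  cont : ∀ᵐ ω ∂P, Continuous (fun t => W t ω)

/-- The regulator `sup_{s ≤ t} [-w s]₊` of a path `w`. -/
def regulator (w : I → ℝ) (t : I) : ℝ := ⨆ s : Set.Iic t, max (-w s) 0

/-- `V` is a Brownian motion regulated from below at zero, started at `w₀ ≥ 0`, with nonzero
variance. -/
def IsRegulatedBrownianMotion {Ω : Type*} [MeasurableSpace Ω]
    (V : I → Ω → ℝ) (w₀ : ℝ) (P : Measure Ω) : Prop :=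
  0 ≤ w₀ ∧ ∃ (W : I → Ω → ℝ) (v : ℝ≥0), 0 < v ∧ IsScalarBrownianMotion W w₀ v P ∧
    ∀ᵐ ω ∂P, ∀ t, V t ω = W t ω + regulator (fun s => W s ω) t

/-! ### Bounded moments and `I*(0)` -/

/-- The random vectors `f i`, `i ∈ s`, have uniformly bounded moments of order `m`. -/
def BoundedMoments {Ω ι E : Type*} [MeasurableSpace Ω] [NormedAddCommGroup E]
    (f : ι → Ω → E) (s : Set ι) (m : ℝ) (P : Measure Ω) : Prop :=
  (∀ i ∈ s, AEStronglyMeasurable (f i) P) ∧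
    ∃ C : ℝ≥0, ∀ i ∈ s, eLpNorm (f i) (ENNReal.ofReal m) P ≤ C

/-- `w ∼ I*(0)`: `max_{1 ≤ t ≤ n} ‖w t‖ = o_p(n^{1/2})`. The sequence is allowed to depend on the
sample size `n`; the case of a single sequence is that of a constant dependence. -/
def IsStarStationary {Ω E : Type*} [MeasurableSpace Ω] [NormedAddCommGroup E]
    (w : ℕ → ℕ → Ω → E) (P : Measure Ω) : Prop :=
  TendstoInMeasure P
    (fun (n : ℕ) ω => (√(n : ℝ))⁻¹ * (((Finset.Icc 1 n).sup fun t => ‖w n t ω‖₊ : ℝ≥0) : ℝ))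
    atTop (fun _ => (0 : ℝ))

/-! ### Matrices -/

/-- A matrix acting on Euclidean vectors. -/
def act {m n : Type*} [Fintype n] (A : Matrix m n ℝ) (v : EuclideanSpace ℝ n) :
    EuclideanSpace ℝ m :=
  WithLp.toLp 2 (A *ᵥ v.ofLp)

/-- The matrix `[v, A]` with first column `v` followed by the columns of `A`. -/
def colCons {m : Type*} {d : ℕ} (v : m → ℝ) (A : Matrix m (Fin d) ℝ) :
    Matrix m (Fin (d + 1)) ℝ :=
  Matrix.of fun a => Fin.cons (v a) (A a)

/-- `B` is an orthocomplement of the full column rank matrix `A`. -/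
def IsOrthocomplement {m n q : ℕ} (A : Matrix (Fin m) (Fin n) ℝ) (B : Matrix (Fin m) (Fin q) ℝ) :
    Prop :=
  n + q = m ∧ B.rank = q ∧ Bᵀ * A = 0

/-- The joint spectral radius `limsup_t sup {ρ(B)^{1/t} : B a t-fold product from S}`, where `ρ` is
the spectral radius (over the complex numbers). -/
def jointSpectralRadius {N : Type*} [Fintype N] [DecidableEq N] (S : Set (Matrix N N ℝ)) : ℝ≥0∞ :=
  limsup (fun t : ℕ => ⨆ L ∈ {L : List (Matrix N N ℝ) | L.length = t ∧ ∀ A ∈ L, A ∈ S},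
    (spectralRadius ℂ (L.prod.map (algebraMap ℝ ℂ))) ^ (1 / (t : ℝ))) atTop

/-! ### The canonical CKSVAR -/

/-- The two regimes of the model. -/
inductive Regime
  | pos
  | neg

/-- The coefficients of a canonical CKSVAR for `z = (y, x) ∈ ℝ^p` with `p = d + 1` variables and
`k = l + 2` lags. Only the coefficients with index `1, …, k` play a role. -/
structure CKSVAR (d l : ℕ) where
  c : Fin (d + 1) → ℝ
  phi : Regime → ℕ → Fin (d + 1) → ℝ
  PhiX : ℕ → Matrix (Fin (d + 1)) (Fin d) ℝ

namespace CKSVAR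

variable {d l : ℕ} (M : CKSVAR d l)

/-- `Φᵢ^± = [φᵢ^±, Φᵢ^x]`. -/
def Phi (s : Regime) (i : ℕ) : Matrix (Fin (d + 1)) (Fin (d + 1)) ℝ :=
  colCons (M.phi s i) (M.PhiX i)

/-- The matrix polynomial `Φ^±(λ) = I - ∑_{i=1}^k Φᵢ^± λ^i`. -/
def arPoly (s : Regime) : Matrix (Fin (d + 1)) (Fin (d + 1)) (Polynomial ℝ) :=
  1 - ∑ i ∈ Finset.Icc 1 (l + 2), (Polynomial.X ^ i : Polynomial ℝ) • (M.Phi s i).map Polynomial.C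

/-- `π^± = -φ^±(1)`, where `φ₀^± = e₁`. -/
def pi (s : Regime) : Fin (d + 1) → ℝ :=
  -(Pi.single 0 1 - ∑ i ∈ Finset.Icc 1 (l + 2), M.phi s i)

/-- `Π^x = -Φ^x(1)`, where `Φ₀^x` consists of the last `p - 1` columns of the identity. -/
def PiX : Matrix (Fin (d + 1)) (Fin d) ℝ :=
  -((1 : Matrix (Fin (d + 1)) (Fin (d + 1)) ℝ).submatrix id Fin.succ
    - ∑ i ∈ Finset.Icc 1 (l + 2), M.PhiX i)

/-- `Π^± = [π^±, Π^x]`. -/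
def PiMat (s : Regime) : Matrix (Fin (d + 1)) (Fin (d + 1)) ℝ :=
  colCons (M.pi s) M.PiX

/-- `Γᵢ^± = -∑_{j=i+1}^k Φⱼ^±`. -/
def Gamma (s : Regime) (i : ℕ) : Matrix (Fin (d + 1)) (Fin (d + 1)) ℝ :=
  -∑ j ∈ Finset.Icc (i + 1) (l + 2), M.Phi s j

/-- `Γ^±(1) = I - ∑_{i=1}^{k-1} Γᵢ^±`. -/
def GammaOne (s : Regime) : Matrix (Fin (d + 1)) (Fin (d + 1)) ℝ :=
  1 - ∑ i ∈ Finset.Icc 1 (l + 1), M.Gamma s i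

/-- The space of common trends `{(y, x) : π⁺[y]₊ + π⁻[y]₋ + Π^x x = 0}`. -/
def commonTrends : Set (EuclideanSpace ℝ (Fin (d + 1))) :=
  {z | max (z 0) 0 • M.pi .pos + min (z 0) 0 • M.pi .neg + M.PiX *ᵥ (fun j => z j.succ) = 0}

/-- `z` satisfies the equations of the model at the times `t ≥ 1`, with errors `u` and initial
values `z t`, `-k + 1 ≤ t ≤ 0`. -/
def IsGenerated {Ω : Type*} (u : ℕ → Ω → EuclideanSpace ℝ (Fin (d + 1)))
    (z : ℤ → Ω → EuclideanSpace ℝ (Fin (d + 1))) : Prop :=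
  ∀ t : ℕ, 1 ≤ t → ∀ ω, z t ω = WithLp.toLp 2 (M.c +
    ∑ i ∈ Finset.Icc 1 (l + 2),
      (max (z (t - i) ω 0) 0 • M.phi .pos i + min (z (t - i) ω 0) 0 • M.phi .neg i
        + M.PhiX i *ᵥ (fun j => z (t - i) ω j.succ))) + u t ω

/-- Unit roots: `det Φ^±(λ)` has `q^±` roots at unity and all others outside the unit circle,
`rank Π^± = r^± = p - q^±`, and `c` lies in the column spaces of `Π⁺` and `Π⁻`. -/
structure HasUnitRoots (q r : Regime → ℕ) : Prop where
  roots_one : ∀ s, (M.arPoly s).det.rootMultiplicity 1 = q s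
  roots_other : ∀ s, ∀ x : ℂ, Polynomial.aeval x (M.arPoly s).det = 0 → x = 1 ∨ 1 < ‖x‖
  rank_eq : ∀ s, (M.PiMat s).rank = r s
  rank_add : ∀ s, r s + q s = d + 1
  intercept : ∀ s, ∃ v, M.PiMat s *ᵥ v = M.c

/-! ### The companion matrices of the short-memory components -/

section Companion

variable {r : ℕ} (α β : Matrix (Fin (d + 1)) (Fin r) ℝ)

/-- The `kp × (r + p(k-1))` matrix with first block row `[α, Γ₁⁺, …, Γ_{k-1}⁺]` and further block
rows `[0, I, 0, …], …, [0, …, 0, I]`. -/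
def boldAlpha :
    Matrix (Fin (l + 2) × Fin (d + 1)) (Fin r ⊕ Fin (l + 1) × Fin (d + 1)) ℝ :=
  Matrix.of fun ja => Sum.elim
    (fun b => if ja.1 = 0 then α ja.2 b else 0)
    (fun mb => if ja.1 = 0 then M.Gamma .pos (mb.1 + 1) ja.2 mb.2
      else if ja.1 = mb.1.succ then (1 : Matrix (Fin (d + 1)) (Fin (d + 1)) ℝ) ja.2 mb.2 else 0)

/-- The `(r + p(k-1)) × kp` matrix with first block row `[βᵀ, 0, …, 0]` and further block rows
`[I, -I, 0, …], …, [0, …, 0, I, -I]`. -/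
def boldBetaT :
    Matrix (Fin r ⊕ Fin (l + 1) × Fin (d + 1)) (Fin (l + 2) × Fin (d + 1)) ℝ :=
  Matrix.of (Sum.elim
    (fun b ja => if ja.1 = 0 then β ja.2 b else 0)
    (fun mb ja => if ja.1 = mb.1.castSucc then
        (1 : Matrix (Fin (d + 1)) (Fin (d + 1)) ℝ) mb.2 ja.2
      else if ja.1 = mb.1.succ then -(1 : Matrix (Fin (d + 1)) (Fin (d + 1)) ℝ) mb.2 ja.2 else 0))

/-- The first `p` columns of `boldBetaT`. -/
def boldBetaTopT : Matrix (Fin r ⊕ Fin (l + 1) × Fin (d + 1)) (Fin (d + 1)) ℝ :=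
  (boldBetaT (l := l) β).submatrix id (fun a => ((0 : Fin (l + 2)), a))

/-- The difference `φᵢ⁻ - φᵢ⁺`. -/
def phiDiff (i : ℕ) : Fin (d + 1) → ℝ := M.phi .neg i - M.phi .pos i

/-- The matrix `F_δ`. Its index set consists of the `r + p(k-1)` equilibrium errors and
differences, of one auxiliary index, and of `k - 1` further indices. -/
def F (δ : ℝ) :
    Matrix ((Fin r ⊕ Fin (l + 1) × Fin (d + 1)) ⊕ (Unit ⊕ Fin (l + 1)))
      ((Fin r ⊕ Fin (l + 1) × Fin (d + 1)) ⊕ (Unit ⊕ Fin (l + 1))) ℝ :=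
  Matrix.fromBlocks
    (1 + boldBetaT (l := l) β * M.boldAlpha α)
    (Matrix.of fun a => Sum.elim
      (fun _ => (boldBetaTopT (l := l) β *ᵥ M.phiDiff 1) a * δ)
      (fun i : Fin (l + 1) => (boldBetaTopT (l := l) β *ᵥ M.phiDiff (i + 2)) a))
    (Matrix.of (Sum.elim (fun _ => M.boldAlpha α (0, 0)) (fun _ => 0)))
    (Matrix.fromBlocks
      (Matrix.of fun _ _ => (1 + M.phiDiff 1 0) * δ)
      (Matrix.of fun _ i => M.phiDiff ((i : ℕ) + 2) 0)
      (Matrix.of fun i _ => if i = 0 then δ else 0)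
      (Matrix.of fun i j => if (i : ℕ) = j + 1 then 1 else 0))

end Companion

/-! ### The limit process -/

section Limit

variable {q : ℕ} (αp βp : Matrix (Fin (d + 1)) (Fin q) ℝ)

/-- `P_{β⊥} = β⊥ [α⊥ᵀ Γ⁺(1) β⊥]⁻¹ α⊥ᵀ`. -/
def proj : Matrix (Fin (d + 1)) (Fin (d + 1)) ℝ :=
  βp * (αpᵀ * M.GammaOne .pos * βp)⁻¹ * αpᵀ

/-- `κ = P_{β⊥} π⁻`. -/
def kappa : Fin (d + 1) → ℝ := M.proj αp βp *ᵥ M.pi .neg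

variable {Ω' : Type*} (Z₀ : EuclideanSpace ℝ (Fin (d + 1)))
  (U : I → Ω' → EuclideanSpace ℝ (Fin (d + 1)))

/-- `P_{β⊥} U₀`, where `U₀ = Γ⁺(1) Z₀ + U`. -/
def projU (t : I) (ω : Ω') : EuclideanSpace ℝ (Fin (d + 1)) :=
  act (M.proj αp βp) (act (M.GammaOne .pos) Z₀ + U t ω)

/-- `P_{β⊥} U₀(t) + κ₁⁻¹ κ sup_{s ≤ t} [-e₁ᵀ P_{β⊥} U₀(s)]₊`. -/
def limitPath (t : I) (ω : Ω') : EuclideanSpace ℝ (Fin (d + 1)) :=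
  M.projU αp βp Z₀ U t ω +
    ((M.kappa αp βp 0)⁻¹ * regulator (fun s => M.projU αp βp Z₀ U s ω 0) t) •
      WithLp.toLp 2 (M.kappa αp βp)

end Limit

end CKSVAR

/-! ### Conditions on the errors and on the initial values -/

/-- The errors `u t`, `t ≥ 1`, have uniformly bounded moments of order `2 + δ`, and their partial
sums converge weakly to a Brownian motion `U` with positive definite variance `S`. -/
structure ErrorCondition {Ω Ω' : Type*} [MeasurableSpace Ω] [MeasurableSpace Ω'] {d : ℕ}
    (P : Measure Ω) [IsProbabilityMeasure P] (P' : Measure Ω') [IsProbabilityMeasure P']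
    (u : ℕ → Ω → EuclideanSpace ℝ (Fin (d + 1))) (δ : ℝ)
    (U : I → Ω' → EuclideanSpace ℝ (Fin (d + 1))) (S : Matrix (Fin (d + 1)) (Fin (d + 1)) ℝ) :
    Prop where
  delta_pos : 0 < δ
  moments : BoundedMoments u {t | 1 ≤ t} (2 + δ) P
  posDef : S.PosDef
  brownian : IsBrownianMotion U S P'
  partialSums : ConvergesWeaklyOnD P P'
    (fun (n : ℕ) t ω => (√(n : ℝ))⁻¹ • ∑ i ∈ Finset.Icc 1 ⌊n * (t : ℝ)⌋₊, u i ω) U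

/-- The conditions on the initial values `z n t`, `-k + 1 ≤ t ≤ 0`, `k = l + 2`, which may depend on
the sample size `n`. The differences `Δz_t` are those between initial values, `-k + 2 ≤ t ≤ 0`. -/
structure InitialCondition {Ω : Type*} [MeasurableSpace Ω] {d l r : ℕ} (M : CKSVAR d l)
    (P : Measure Ω) (β : Matrix (Fin (d + 1)) (Fin r) ℝ) (δ : ℝ)
    (z : ℕ → ℤ → Ω → EuclideanSpace ℝ (Fin (d + 1)))
    (Z₀ : EuclideanSpace ℝ (Fin (d + 1))) : Prop where
  measurable : ∀ n, ∀ t : ℤ, -(l + 1 : ℤ) ≤ t → t ≤ 0 → AEMeasurable (z n t) P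
  moments_eqErr : BoundedMoments (fun (i : ℕ × ℤ) ω => act βᵀ (z i.1 i.2 ω))
    {i | -(l + 1 : ℤ) ≤ i.2 ∧ i.2 ≤ 0} (2 + δ) P
  moments_neg : BoundedMoments (fun (i : ℕ × ℤ) ω => min (z i.1 i.2 ω 0) 0)
    {i | -(l + 1 : ℤ) ≤ i.2 ∧ i.2 ≤ 0} (2 + δ) P
  moments_diff : BoundedMoments (fun (i : ℕ × ℤ) ω => z i.1 i.2 ω - z i.1 (i.2 - 1) ω)
    {i | -(l : ℤ) ≤ i.2 ∧ i.2 ≤ 0} (2 + δ) P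
  tendsto : TendstoInMeasure P (fun (n : ℕ) ω => (√(n : ℝ))⁻¹ • z n 0 ω) atTop (fun _ => Z₀)
  mem : Z₀ ∈ M.commonTrends

end

end RegCoint

namespace RegCoint

noncomputable section

/-! Written with the coefficients of the positive regime throughout, the model is a linear
error-correction system driven by the shocks and by y⁻. Its short-memory components are small path
by path, and its common trend solves a discrete Skorokhod problem up to errors of that small size.

Short memory. The vector of βᵀz_t, the lagged differences, y_t - y_{t-1}⁺ and the lagged y⁻ obeys a
recursion with matrix F_δ, where δ in [0,1] depends on the path (`IsPath.state_succ`). As F_δ is a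
convex combination of F_0 and F_1, a norm contracted by these two is contracted at every step. It
exists by the Berger–Wang theorem (`exists_contracting_seminorm`), which rests on Burnside's
theorem. Hence these components are at most a constant times B, a bound for the shocks and initial
short-memory terms (`exists_shortMemoryBound`), and moments of order 2 + δ_u make B = o_p(√n)
(`BoundedMoments.vanishes_sup`). This is (i).

Trend. P annihilates Π⁺ and c, so applying P and summing over time gives PΓ⁺(1)z_t = trend + κ L_t +
O(B), with L_t the sum of y_s⁻ over 1 ≤ s ≤ t. Since PΓ⁺(1) is the identity on ker βᵀ, z_t itself
has this form. In the first coordinate, y_t = v_t + κ₁L_t + O(B), where κ₁L_t starts at 0, is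
nondecreasing, grows only when y_t < 0, and y_t ≥ -O(B). These properties force κ₁L_t to be within
O(B) of the running maximum of [-v]₊ (`discrete_skorokhod`).

Limit. The rescaled process is thus uniformly within o_p(1) of a Lipschitz functional of the
rescaled partial sums (`exists_norm_sub_limitPath_le`, `continuous_limitMap`). Continuous mapping
and `tendstoInDistribution_of_vanishes`, which is valid on the nonseparable space D[0,1], give (ii).
-/

/-! ### Burnside's theorem on matrix algebras -/

/-- **Burnside's theorem**: an irreducible algebra of endomorphisms of a finite-dimensional space
over an algebraically closed field consists of all endomorphisms. -/
theorem subalgebra_eq_top_of_irreducible {K V : Type*} [Field K] [IsAlgClosed K] [AddCommGroup V]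
    [Module K V] [FiniteDimensional K V] [Nontrivial V] (A : Subalgebra K (Module.End K V))
    (h : ∀ W : Submodule K V, (∀ a ∈ A, ∀ w ∈ W, a w ∈ W) → W = ⊥ ∨ W = ⊤) : A = ⊤ := by
  have hsimple : IsSimpleModule A V := by
    rw [isSimpleModule_iff]
    refine { eq_bot_or_eq_top := fun W => ?_ }
    have := h (W.restrictScalars K) (fun a ha w hw => W.smul_mem (⟨a, ha⟩ : A) hw)
    simpa using this
  -- Schur's lemma: φ has an eigenvalue c, so φ - c is not injective and must vanish.
  have hscalar : ∀ φ : Module.End A V, ∃ c : K, ∀ v, φ v = c • v := by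
    intro φ
    obtain ⟨c, hc⟩ := Module.End.exists_eigenvalue (φ.restrictScalars K : Module.End K V)
    obtain ⟨v, hv⟩ := hc.exists_hasEigenvector
    refine ⟨c, ?_⟩
    let ψ : Module.End A V := φ - algebraMap K (Module.End A V) c
    have hψ : ∀ v, ψ v = φ v - c • v := fun v => by
      simp [ψ, Module.algebraMap_end_apply]
    rcases LinearMap.injective_or_eq_zero ψ with h1 | h1
    · exfalso
      apply hv.2
      apply h1
      rw [map_zero, hψ]
      have := hv.apply_eq_smul
      simp only [LinearMap.coe_restrictScalars] at this
      rw [this, sub_self]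
    · intro v
      have := hψ v
      rw [h1] at this
      exact (sub_eq_zero.1 this.symm)
  rw [eq_top_iff]
  intro g _
  -- The commutant of `A` being scalar, every linear map commutes with it, and the density theorem
  -- yields an element of `A` that agrees with g on a basis.
  let g' : Module.End (Module.End A V) V :=
    { toFun := g
      map_add' := g.map_add
      map_smul' := fun φ v => by
        obtain ⟨c, hc⟩ := hscalar φ
        simp only [Module.End.smul_def, hc, map_smul, RingHom.id_apply] }
  let b := Module.finBasis K V
  classical
  obtain ⟨a, ha⟩ := jacobson_density (R := A) g' (Finset.univ.image b)
  have : g = a.1 := b.ext fun i => ha (b i) (by simp)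
  rw [this]
  exact a.2

/-! ### Contracting norms and the Berger–Wang theorem -/

/-- A family of endomorphisms contracts some norm by a common factor. -/
def IsContractive {ι V : Type*} [AddCommGroup V] [Module ℂ V] (f : ι → Module.End ℂ V) : Prop :=
  ∃ (p : Seminorm ℂ V) (θ : ℝ), 0 ≤ θ ∧ θ < 1 ∧ (∀ v, p v = 0 → v = 0) ∧
    ∀ i v, p (f i v) ≤ θ * p v

/-- The eigenvalues of the products of `t` members of the family are `O(θ ^ t)`. -/
def HasEigenvalueBound {ι V : Type*} [AddCommGroup V] [Module ℂ V] (f : ι → Module.End ℂ V)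
    (C θ : ℝ) : Prop :=
  ∀ (w : List ι) (μ : ℂ), Module.End.HasEigenvalue (w.map f).prod μ → ‖μ‖ ≤ C * θ ^ w.length

theorem norm_trace_le {V : Type*} [AddCommGroup V] [Module ℂ V] [FiniteDimensional ℂ V]
    (g : Module.End ℂ V) {c : ℝ} (h : ∀ μ, Module.End.HasEigenvalue g μ → ‖μ‖ ≤ c) :
    ‖LinearMap.trace ℂ V g‖ ≤ Module.finrank ℂ V * c := by
  rw [Module.End.trace_eq_sum_roots_charpoly_of_splits (IsAlgClosed.splits _)]
  refine (norm_multiset_sum_le _).trans ?_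
  have h1 : (g.charpoly.roots.map fun a => ‖a‖).sum ≤
      (g.charpoly.roots.map fun a => ‖a‖).card • c := by
    apply Multiset.sum_le_card_nsmul
    intro x hx
    obtain ⟨a, ha, rfl⟩ := Multiset.mem_map.1 hx
    apply h
    rw [Module.End.hasEigenvalue_iff_isRoot_charpoly]
    exact Polynomial.isRoot_of_mem_roots ha
  refine h1.trans (le_of_eq ?_)
  rw [Multiset.card_map, nsmul_eq_mul, ← g.charpoly_natDegree,
    (IsAlgClosed.splits g.charpoly).natDegree_eq_card_roots]

/-- The X with such a bound form a subspace. It contains every product of the family, because X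
times a word is then a longer word whose trace is controlled by its eigenvalues; by Burnside's
theorem these products span all endomorphisms. -/
theorem exists_bound_of_irreducible {ι V : Type*} [AddCommGroup V] [Module ℂ V]
    [FiniteDimensional ℂ V] [Nontrivial V] (f : ι → Module.End ℂ V) {C θ : ℝ}
    (hf : HasEigenvalueBound f C θ)
    (h : ∀ W : Submodule ℂ V, (∀ i, ∀ w ∈ W, f i w ∈ W) → W = ⊥ ∨ W = ⊤)
    (X : Module.End ℂ V) :
    ∃ D : ℝ, ∀ w : List ι, ‖LinearMap.trace ℂ V (X * (w.map f).prod)‖ ≤ D * θ ^ w.length := by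
  let T : Submodule ℂ (Module.End ℂ V) :=
    { carrier := {X | ∃ D : ℝ, ∀ w : List ι,
        ‖LinearMap.trace ℂ V (X * (w.map f).prod)‖ ≤ D * θ ^ w.length}
      zero_mem' := ⟨0, by simp⟩
      add_mem' := by
        rintro X Y ⟨D, hD⟩ ⟨E, hE⟩
        refine ⟨D + E, fun w => ?_⟩
        rw [add_mul, map_add, add_mul]
        exact (norm_add_le _ _).trans (add_le_add (hD w) (hE w))
      smul_mem' := by
        rintro c X ⟨D, hD⟩
        refine ⟨‖c‖ * D, fun w => ?_⟩
        rw [smul_mul_assoc, map_smul, norm_smul, mul_assoc]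
        exact mul_le_mul_of_nonneg_left (hD w) (norm_nonneg _) }
  have hA : Algebra.adjoin ℂ (Set.range f) = ⊤ := by
    apply subalgebra_eq_top_of_irreducible
    intro W hW
    exact h W fun i w hw => hW (f i) (Algebra.subset_adjoin ⟨i, rfl⟩) w hw
  have hT : Subalgebra.toSubmodule (Algebra.adjoin ℂ (Set.range f)) ≤ T := by
    rw [Algebra.adjoin_eq_span, Submodule.span_le]
    intro Y hY
    obtain ⟨L, hL, rfl⟩ := Submonoid.exists_list_of_mem_closure hY
    obtain ⟨u, rfl⟩ : ∃ u : List ι, L = u.map f := by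
      have : L ∈ Set.range (List.map f) := by rw [Set.range_list_map]; exact hL
      obtain ⟨u, hu⟩ := this
      exact ⟨u, hu.symm⟩
    refine ⟨Module.finrank ℂ V * (C * θ ^ u.length), fun w => ?_⟩
    rw [← List.prod_append, ← List.map_append]
    refine (norm_trace_le _ (hf (u ++ w))).trans (le_of_eq ?_)
    rw [List.length_append, pow_add]
    ring
  have : X ∈ T := hT (by rw [hA]; trivial)
  exact this

/-- For X of rank one the trace bound says that the coordinates of w v are O(θ^|w|). The supremum
over all words w of θ^(-|w|)‖w v‖ is therefore finite; it is a norm, and appending a letter to w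
shows that every member of the family contracts it by θ. -/
theorem isContractive_of_irreducible {ι V : Type*} [AddCommGroup V] [Module ℂ V]
    [FiniteDimensional ℂ V] [Nontrivial V] (f : ι → Module.End ℂ V) {C θ : ℝ} (hθ : 0 < θ)
    (hθ1 : θ < 1) (hf : HasEigenvalueBound f C θ)
    (h : ∀ W : Submodule ℂ V, (∀ i, ∀ w ∈ W, f i w ∈ W) → W = ⊥ ∨ W = ⊤) :
    IsContractive f := by
  let b := Module.finBasis ℂ V
  let q : Seminorm ℂ V := (normSeminorm ℂ (Fin (Module.finrank ℂ V) → ℂ)).comp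
    (b.equivFun : V →ₗ[ℂ] (Fin (Module.finrank ℂ V) → ℂ))
  have hq : ∀ v, q v = ‖b.equivFun v‖ := fun v => rfl
  let s : List ι → Seminorm ℂ V := fun w => (θ⁻¹ ^ w.length).toNNReal • q.comp (w.map f).prod
  have hs : ∀ w v, s w v = θ⁻¹ ^ w.length * q ((w.map f).prod v) := fun w v => by
    change ((θ⁻¹ ^ w.length).toNNReal : ℝ) * _ = _
    rw [Real.coe_toNNReal _ (by positivity)]
    rfl
  have hbdd : ∀ v, BddAbove (Set.range fun w => s w v) := by
    intro v
    have h1 : ∀ i, ∃ D : ℝ, ∀ w : List ι, ‖b.coord i ((w.map f).prod v)‖ ≤ D * θ ^ w.length := by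
      intro i
      obtain ⟨D, hD⟩ := exists_bound_of_irreducible f hf h ((b.coord i).smulRight v)
      refine ⟨D, fun w => ?_⟩
      have h2 := hD w
      have h3 : (w.map f).prod * (b.coord i).smulRight v =
          (b.coord i).smulRight ((w.map f).prod v) := by
        ext x
        simp
      rwa [LinearMap.trace_mul_comm, h3, LinearMap.trace_smulRight] at h2
    choose D hD using h1
    refine ⟨∑ i, |D i|, ?_⟩
    rintro _ ⟨w, rfl⟩
    simp only
    rw [hs, hq, inv_pow, inv_mul_le_iff₀ (by positivity)]
    rw [pi_norm_le_iff_of_nonneg (by positivity)]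
    intro i
    refine (hD i w).trans ?_
    rw [mul_comm]
    gcongr
    exact (le_abs_self _).trans
      (Finset.single_le_sum (f := fun i => |D i|) (fun _ _ => abs_nonneg _) (Finset.mem_univ i))
  have hbdd' : BddAbove (Set.range s) := Seminorm.bddAbove_range_iff.2 hbdd
  refine ⟨⨆ w, s w, θ, hθ.le, hθ1, fun v hv => ?_, fun i v => ?_⟩
  · rw [Seminorm.iSup_apply hbdd'] at hv
    have h1 := le_ciSup (hbdd v) []
    rw [hv, hs] at h1
    simp only [List.length_nil, pow_zero, one_mul, List.map_nil, List.prod_nil,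
      Module.End.one_apply, hq] at h1
    simpa using h1
  · rw [Seminorm.iSup_apply hbdd', Seminorm.iSup_apply hbdd']
    refine ciSup_le fun w => ?_
    have h1 := le_ciSup (hbdd v) (w ++ [i])
    rw [hs] at h1
    rw [hs]
    simp only [List.length_append, List.length_singleton, List.map_append, List.prod_append,
      List.map_singleton, List.prod_singleton, Module.End.mul_apply] at h1
    rw [← inv_mul_le_iff₀ hθ]
    refine le_trans (le_of_eq ?_) h1
    rw [pow_succ]
    ring

theorem Seminorm.exists_le_mul_of_definite {V : Type*} [AddCommGroup V] [Module ℂ V]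
    [FiniteDimensional ℂ V] (p s : Seminorm ℂ V) (hp : ∀ v, p v = 0 → v = 0) :
    ∃ K : ℝ, 0 ≤ K ∧ ∀ v, s v ≤ K * p v := by
  let : NormedAddCommGroup V := AddGroupNorm.toNormedAddCommGroup
    { toFun := p, map_zero' := map_zero p, add_le' := map_add_le_add p, neg' := map_neg_eq_map p,
      eq_zero_of_map_eq_zero' := hp }
  let : NormedSpace ℂ V := { norm_smul_le := fun c v => (map_smul_eq_mul p c v).le }
  have hn : ∀ v : V, ‖v‖ = p v := fun v => rfl
  let b := Module.finBasis ℂ V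
  refine ⟨∑ i, ‖LinearMap.toContinuousLinearMap (b.coord i)‖ * s (b i), by positivity, ?_⟩
  intro v
  calc s v = s (∑ i, b.coord i v • b i) := by simp [b.sum_repr]
    _ ≤ ∑ i, s (b.coord i v • b i) := by
      exact Finset.le_sum_of_subadditive s (map_zero s).le (map_add_le_add s) _ _
    _ ≤ ∑ i, ‖LinearMap.toContinuousLinearMap (b.coord i)‖ * s (b i) * p v := by
      refine Finset.sum_le_sum fun i _ => ?_
      rw [map_smul_eq_mul, mul_right_comm]
      gcongr
      exact (LinearMap.toContinuousLinearMap (b.coord i)).le_opNorm v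
    _ = _ := by rw [Finset.sum_mul]

theorem coe_prod_restrict {ι V : Type*} [AddCommGroup V] [Module ℂ V] (f : ι → Module.End ℂ V)
    (W : Submodule ℂ V) (hW : ∀ i, ∀ w ∈ W, f i w ∈ W) (L : List ι) (x : W) :
    (((L.map fun i => (f i).restrict (hW i)).prod x : W) : V) = (L.map f).prod x := by
  induction L with
  | nil => simp
  | cons i L ih => simp [Module.End.mul_apply, ih]

theorem prod_mapQ_mk {ι V : Type*} [AddCommGroup V] [Module ℂ V] (f : ι → Module.End ℂ V)
    (W : Submodule ℂ V) (hW : ∀ i, W ≤ W.comap (f i)) (L : List ι) (x : V) :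
    (L.map fun i => W.mapQ W (f i) (hW i)).prod (Submodule.Quotient.mk x) =
      Submodule.Quotient.mk ((L.map f).prod x) := by
  induction L with
  | nil => simp
  | cons i L ih => simp [Module.End.mul_apply, ih]

theorem HasEigenvalueBound.restrict {ι V : Type*} [AddCommGroup V] [Module ℂ V]
    {f : ι → Module.End ℂ V} {C θ : ℝ} (hf : HasEigenvalueBound f C θ)
    (W : Submodule ℂ V) (hW : ∀ i, ∀ w ∈ W, f i w ∈ W) :
    HasEigenvalueBound (fun i => (f i).restrict (hW i)) C θ := by
  intro L μ hμ
  obtain ⟨x, hx⟩ := hμ.exists_hasEigenvector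
  apply hf L μ
  apply Module.End.hasEigenvalue_of_hasEigenvector (x := (x : V))
  refine Module.End.hasEigenvector_iff.2 ⟨Module.End.mem_eigenspace_iff.2 ?_, by simpa using hx.2⟩
  rw [← coe_prod_restrict f W hW, hx.apply_eq_smul]
  rfl

/-- If μ is not an eigenvalue on V, the product minus μ is bijective there, hence surjective on the
quotient, hence injective on it by finite dimension. -/
theorem HasEigenvalueBound.mapQ {ι V : Type*} [AddCommGroup V] [Module ℂ V]
    [FiniteDimensional ℂ V] {f : ι → Module.End ℂ V} {C θ : ℝ} (hf : HasEigenvalueBound f C θ)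
    (W : Submodule ℂ V) (hW : ∀ i, W ≤ W.comap (f i)) :
    HasEigenvalueBound (fun i => W.mapQ W (f i) (hW i)) C θ := by
  intro L μ hμ
  apply hf L μ
  by_contra hcon
  obtain ⟨x, hx⟩ := hμ.exists_hasEigenvector
  have hinj : Function.Injective ((L.map f).prod - algebraMap ℂ (Module.End ℂ V) μ) := by
    rw [← LinearMap.ker_eq_bot]
    rw [Module.End.hasEigenvalue_iff, not_not, Module.End.eigenspace_def] at hcon
    exact hcon
  have hsurj := LinearMap.injective_iff_surjective.1 hinj
  let g := (L.map fun i => W.mapQ W (f i) (hW i)).prod - algebraMap ℂ (Module.End ℂ (V ⧸ W)) μ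
  have hg : Function.Surjective g := by
    intro y
    obtain ⟨y, rfl⟩ := Submodule.Quotient.mk_surjective W y
    obtain ⟨v, rfl⟩ := hsurj y
    refine ⟨Submodule.Quotient.mk v, ?_⟩
    simp [g, prod_mapQ_mk, Module.algebraMap_end_apply]
  apply hx.2
  apply LinearMap.injective_iff_surjective.2 hg
  simp [g, hx.apply_eq_smul, Module.algebraMap_end_apply]

/-- Along a complement of W the family is block triangular. Giving the quotient norm a large weight
makes the off-diagonal blocks harmless, at the cost of a contraction factor τ between the two given
ones and 1. -/
theorem isContractive_of_invariant {ι V : Type*} [AddCommGroup V] [Module ℂ V]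
    [FiniteDimensional ℂ V] [Finite ι] {f : ι → Module.End ℂ V}
    (W : Submodule ℂ V) (hW : ∀ i, ∀ w ∈ W, f i w ∈ W)
    (h1 : IsContractive fun i => (f i).restrict (hW i))
    (h2 : IsContractive fun i => W.mapQ W (f i) (hW i)) : IsContractive f := by
  obtain ⟨p, θ, hθ, hθ1, hp, hpf⟩ := h1
  obtain ⟨p', θ', hθ', hθ1', hp', hpf'⟩ := h2
  obtain ⟨pr, hpr⟩ := W.subtype.exists_leftInverse_of_injective W.ker_subtype
  have hpr' : ∀ x : W, pr x = x := fun x => LinearMap.congr_fun hpr x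
  have hle : W ≤ LinearMap.ker (LinearMap.id - W.subtype ∘ₗ pr) := by
    intro x hx
    have := hpr' ⟨x, hx⟩
    simp only at this
    simp [LinearMap.mem_ker, this]
  let sec : V ⧸ W →ₗ[ℂ] V := W.liftQ (LinearMap.id - W.subtype ∘ₗ pr) hle
  have hsec : ∀ v, v = (pr v : V) + sec (Submodule.Quotient.mk v) := fun v => by
    simp [sec, Submodule.liftQ_apply]
  have hK : ∀ i, ∃ K : ℝ, 0 ≤ K ∧ ∀ x, (p.comp (pr ∘ₗ f i ∘ₗ sec)) x ≤ K * p' x := fun i =>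
    Seminorm.exists_le_mul_of_definite p' _ hp'
  choose K hK0 hK using hK
  have := Fintype.ofFinite ι
  let τ := (max θ θ' + 1) / 2
  have hτ1 : τ < 1 := by
    have : max θ θ' < 1 := max_lt hθ1 hθ1'
    simp only [τ]; linarith
  have hτθ : θ ≤ τ := by
    have := le_max_left θ θ'
    simp only [τ]; linarith
  have hτθ' : θ' < τ := by
    have := le_max_right θ θ'
    simp only [τ]; linarith
  -- The weight is chosen so that (τ - θ')M exceeds every K i, which is what absorbs the
  -- off-diagonal terms.
  let M : ℝ := (∑ i, K i) / (τ - θ') + 1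
  have hM0 : 0 ≤ (∑ i, K i) / (τ - θ') :=
    div_nonneg (Finset.sum_nonneg fun i _ => hK0 i) (by linarith)
  have hM : 0 < M := by simp only [M]; linarith
  have hKM : ∀ i, K i + M * θ' ≤ τ * M := by
    intro i
    have h3 : K i ≤ ∑ i, K i := Finset.single_le_sum (fun i _ => hK0 i) (Finset.mem_univ i)
    have h4 : (τ - θ') * M = ∑ i, K i + (τ - θ') := by
      have : τ - θ' ≠ 0 := by linarith
      simp only [M]; field_simp
    nlinarith
  refine ⟨p.comp pr + M.toNNReal • p'.comp W.mkQ, τ, by linarith, hτ1, ?_, ?_⟩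
  · intro v hv
    have hv' : p (pr v) + M * p' (Submodule.Quotient.mk v) = 0 := by
      have : (M.toNNReal : ℝ) = M := Real.coe_toNNReal _ hM.le
      rw [← this]; exact hv
    have h3 : 0 ≤ p (pr v) := apply_nonneg p _
    have h4 : 0 ≤ p' (Submodule.Quotient.mk v) := apply_nonneg p' _
    have h5 : p' (Submodule.Quotient.mk v) = 0 := by nlinarith
    have h6 : p (pr v) = 0 := by rw [h5] at hv'; linarith
    rw [hsec v, hp _ h6, hp' _ h5]
    simp
  · intro i v
    have happ : ∀ v, (p.comp pr + M.toNNReal • p'.comp W.mkQ) v =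
        p (pr v) + M * p' (Submodule.Quotient.mk v) := by
      intro v
      have : (M.toNNReal : ℝ) = M := Real.coe_toNNReal _ hM.le
      conv_rhs => rw [← this]
      rfl
    rw [happ, happ]
    have h3 : p (pr (f i v)) ≤ θ * p (pr v) + K i * p' (Submodule.Quotient.mk v) := by
      have h4 : pr (f i v) = (f i).restrict (hW i) (pr v) +
          pr (f i (sec (Submodule.Quotient.mk v))) := by
        conv_lhs => rw [hsec v, map_add, map_add]
        congr 1
        exact hpr' ((f i).restrict (hW i) (pr v))
      rw [h4]
      exact (map_add_le_add p _ _).trans (add_le_add (hpf i _) (hK i _))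
    have h5 := hpf' i (Submodule.Quotient.mk v)
    simp only [Submodule.mapQ_apply] at h5
    have h6 : 0 ≤ p (pr v) := apply_nonneg p _
    have h7 : 0 ≤ p' (Submodule.Quotient.mk v) := apply_nonneg p' _
    calc p (pr (f i v)) + M * p' (Submodule.Quotient.mk (f i v))
        ≤ θ * p (pr v) + K i * p' (Submodule.Quotient.mk v) +
          M * (θ' * p' (Submodule.Quotient.mk v)) := by gcongr
      _ = θ * p (pr v) + (K i + M * θ') * p' (Submodule.Quotient.mk v) := by ring
      _ ≤ τ * p (pr v) + τ * M * p' (Submodule.Quotient.mk v) := by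
        gcongr
        exact hKM i
      _ = _ := by ring

/-- A finite family of endomorphisms whose products have exponentially small eigenvalues
contracts a norm. -/
theorem isContractive_of_hasEigenvalueBound {ι : Type*} [Finite ι] {C θ : ℝ} (hθ : 0 < θ)
    (hθ1 : θ < 1) (n : ℕ) : ∀ (V : Type*) [AddCommGroup V] [Module ℂ V] [FiniteDimensional ℂ V]
    (f : ι → Module.End ℂ V), Module.finrank ℂ V = n → HasEigenvalueBound f C θ →
    IsContractive f := by
  induction n using Nat.strong_induction_on with
  | _ n ih =>
    intro V _ _ _ f hn hf
    by_cases hV : Nontrivial V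
    · by_cases h : ∀ W : Submodule ℂ V, (∀ i, ∀ w ∈ W, f i w ∈ W) → W = ⊥ ∨ W = ⊤
      · exact isContractive_of_irreducible f hθ hθ1 hf h
      · push Not at h
        -- A proper nonzero invariant subspace and its quotient have smaller dimension and inherit
        -- the eigenvalue bound.
        obtain ⟨W, hW, hbot, htop⟩ := h
        have hlt : Module.finrank ℂ W < n := hn ▸ Submodule.finrank_lt htop
        have hlt' : Module.finrank ℂ (V ⧸ W) < n := by
          have h1 := W.finrank_quotient_add_finrank
          have h2 : 0 < Module.finrank ℂ W := by
            rw [Nat.pos_iff_ne_zero]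
            exact fun h => hbot (Submodule.finrank_eq_zero.1 h)
          omega
        exact isContractive_of_invariant W hW (ih _ hlt W _ rfl (hf.restrict W hW))
          (ih _ hlt' (V ⧸ W) _ rfl (hf.mapQ W hW))
    · rw [not_nontrivial_iff_subsingleton] at hV
      refine ⟨0, 0, le_rfl, zero_lt_one, fun v _ => Subsingleton.elim _ _, fun i v => by simp⟩

/-- For long words the limsup gives the bound with constant 1. The short words are finitely many,
each with finitely many eigenvalues, and are absorbed in C. -/
theorem exists_hasEigenvalueBound_of_jointSpectralRadius_lt_one {N : Type*} [Fintype N]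
    [DecidableEq N] {S : Set (Matrix N N ℝ)} (hS : S.Finite) (h : jointSpectralRadius S < 1) :
    ∃ C θ : ℝ, 0 < θ ∧ θ < 1 ∧
      HasEigenvalueBound (fun A : S => Matrix.toLin' (A.1.map (algebraMap ℝ ℂ))) C θ := by
  obtain ⟨θ, hθ, hθ1⟩ := exists_between h
  have hθtop : θ ≠ ⊤ := (hθ1.trans ENNReal.one_lt_top).ne
  have hev := eventually_lt_of_limsup_lt hθ
  obtain ⟨T, hT⟩ := eventually_atTop.1 hev
  have hθ0 : 0 < θ.toReal := ENNReal.toReal_pos (pos_of_gt hθ).ne' hθtop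
  let f : S → Module.End ℂ (N → ℂ) := fun A => Matrix.toLin' (A.1.map (algebraMap ℝ ℂ))
  have hprod : ∀ w : List S, (w.map f).prod =
      Matrix.toLin' ((w.map Subtype.val).prod.map (algebraMap ℝ ℂ)) := by
    intro w
    induction w with
    | nil => simp [Module.End.one_eq_id]
    | cons A w ih =>
      rw [List.map_cons, List.prod_cons, ih, List.map_cons, List.prod_cons, Matrix.map_mul,
        Matrix.toLin'_mul]
      rfl
  have hspec : ∀ (w : List S) (μ : ℂ), Module.End.HasEigenvalue (w.map f).prod μ →
      (‖μ‖₊ : ℝ≥0∞) ≤ spectralRadius ℂ ((w.map Subtype.val).prod.map (algebraMap ℝ ℂ)) := by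
    intro w μ hμ
    rw [hprod] at hμ
    have := hμ.mem_spectrum
    rw [Matrix.spectrum_toLin'] at this
    exact le_iSup₂ (f := fun k (_ : k ∈ spectrum ℂ _) => (‖k‖₊ : ℝ≥0∞)) μ this
  -- The length must be positive for the exponent `1 / t` to be inverted.
  have hlarge : ∀ (w : List S) (μ : ℂ), max T 1 ≤ w.length →
      Module.End.HasEigenvalue (w.map f).prod μ → ‖μ‖ ≤ θ.toReal ^ w.length := by
    intro w μ hw hμ
    have h1 := (hspec w μ hμ)
    have h2 : spectralRadius ℂ ((w.map Subtype.val).prod.map (algebraMap ℝ ℂ)) ^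
        (1 / (w.length : ℝ)) ≤ θ := by
      refine le_trans ?_ (hT w.length (le_trans (le_max_left _ _) hw)).le
      refine le_iSup₂ (f := fun (L : List (Matrix N N ℝ)) (_ : L ∈ {L : List (Matrix N N ℝ) |
        L.length = w.length ∧ ∀ A ∈ L, A ∈ S}) =>
        (spectralRadius ℂ (L.prod.map (algebraMap ℝ ℂ))) ^ (1 / (w.length : ℝ)))
        (w.map Subtype.val) ⟨by simp, ?_⟩
      intro A hA
      obtain ⟨B, _, rfl⟩ := List.mem_map.1 hA
      exact B.2
    have hpos : (0 : ℝ) < w.length := by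
      exact_mod_cast lt_of_lt_of_le (Nat.lt_of_lt_of_le zero_lt_one (le_max_right T 1)) hw
    have h3 : (‖μ‖₊ : ℝ≥0∞) ≤ θ ^ w.length := by
      refine h1.trans ?_
      rw [one_div, ENNReal.rpow_inv_le_iff hpos, ENNReal.rpow_natCast] at h2
      exact h2
    have h4 := ENNReal.toReal_mono (ENNReal.pow_ne_top hθtop) h3
    simpa using h4
  have hfin : ∀ w : List S, ∃ c : ℝ, ∀ μ : ℂ, Module.End.HasEigenvalue (w.map f).prod μ →
      ‖μ‖ ≤ c := by
    intro w
    obtain ⟨c, hc⟩ := ((Module.End.finite_hasEigenvalue (w.map f).prod).image (‖·‖)).bddAbove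
    exact ⟨c, fun μ hμ => hc ⟨μ, hμ, rfl⟩⟩
  choose c hc using hfin
  have := hS.to_subtype
  have hwords : {w : List S | w.length ≤ max T 1}.Finite := List.finite_length_le S _
  refine ⟨1 + ∑ w ∈ hwords.toFinset, |c w| * θ.toReal⁻¹ ^ w.length, θ.toReal, hθ0, ?_, ?_⟩
  · simpa using (ENNReal.toReal_lt_toReal hθtop ENNReal.one_ne_top).2 hθ1
  · intro w μ hμ
    have hnn : ∀ w ∈ hwords.toFinset, 0 ≤ |c w| * θ.toReal⁻¹ ^ w.length := fun w _ => by positivity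
    rcases le_total (max T 1) w.length with hw | hw
    · refine (hlarge w μ hw hμ).trans ?_
      have := Finset.sum_nonneg hnn
      nlinarith [pow_pos hθ0 w.length]
    · have h1 := Finset.single_le_sum hnn (hwords.mem_toFinset.2 hw)
      calc ‖μ‖ ≤ |c w| := (hc w μ hμ).trans (le_abs_self _)
        _ = |c w| * θ.toReal⁻¹ ^ w.length * θ.toReal ^ w.length := by
          rw [inv_pow]; field_simp
        _ ≤ _ := by gcongr; linarith

/-- **Berger–Wang theorem**: a finite set of matrices with joint spectral radius less than one
contracts a norm. -/
theorem exists_contracting_seminorm {N : Type*} [Fintype N]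
    [DecidableEq N] {S : Set (Matrix N N ℝ)} (hS : S.Finite) (h : jointSpectralRadius S < 1) :
    ∃ (p : Seminorm ℝ (N → ℝ)) (θ K : ℝ), 0 ≤ θ ∧ θ < 1 ∧ 0 ≤ K ∧ (∀ v, ‖v‖ ≤ K * p v) ∧
      (∀ v, p v ≤ K * ‖v‖) ∧ ∀ A ∈ S, ∀ v, p (A *ᵥ v) ≤ θ * p v := by
  obtain ⟨C, τ, hτ, hτ1, hb⟩ := exists_hasEigenvalueBound_of_jointSpectralRadius_lt_one hS h
  have := hS.to_subtype
  obtain ⟨p, θ, hθ, hθ1, hp, hpf⟩ :=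
    isContractive_of_hasEigenvalueBound hτ hτ1 _ _ _ rfl hb
  obtain ⟨K, hK0, hK⟩ := Seminorm.exists_le_mul_of_definite p (normSeminorm ℂ (N → ℂ)) hp
  obtain ⟨K', hK0', hK'⟩ := Seminorm.exists_le_mul_of_definite (normSeminorm ℂ (N → ℂ)) p
    (fun v hv => norm_eq_zero.1 hv)
  -- The complex norm is pulled back along the inclusion of the real vectors, which intertwines the
  -- real matrices with their complexifications.
  let e : (N → ℝ) →ₗ[ℝ] (N → ℂ) :=
    { toFun := fun v i => (v i : ℂ), map_add' := fun _ _ => by ext; simp,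
      map_smul' := fun _ _ => by ext; simp }
  have he : ∀ v, ‖e v‖ = ‖v‖ := by
    intro v
    simp [e, Pi.norm_def]
  refine ⟨(p.restrictScalars ℝ).comp e, θ, max K K', hθ, hθ1, le_max_of_le_left hK0, ?_, ?_, ?_⟩
  · intro v
    rw [← he]
    refine (hK (e v)).trans ?_
    exact mul_le_mul_of_nonneg_right (le_max_left _ _) (apply_nonneg _ _)
  · intro v
    rw [← he]
    refine (hK' (e v)).trans ?_
    exact mul_le_mul_of_nonneg_right (le_max_right _ _) (apply_nonneg _ _)
  · intro A hA v
    have h1 : e (A *ᵥ v) = Matrix.toLin' (A.map (algebraMap ℝ ℂ)) (e v) := by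
      ext i
      simp [e, Matrix.mulVec, dotProduct]
    change p (e (A *ᵥ v)) ≤ θ * p (e v)
    rw [h1]
    exact hpf ⟨A, hA⟩ (e v)

namespace CKSVAR

variable {d l : ℕ} (M : CKSVAR d l)

/-! ### The error-correction form -/

/-- The equations of the model along a single path. -/
def IsPath (u : ℕ → Fin (d + 1) → ℝ) (z : ℤ → Fin (d + 1) → ℝ) : Prop :=
  ∀ t : ℕ, 1 ≤ t → z t = M.c + ∑ i ∈ Finset.Icc 1 (l + 2),
      (max (z (t - i) 0) 0 • M.phi .pos i + min (z (t - i) 0) 0 • M.phi .neg i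
        + M.PhiX i *ᵥ (fun j => z (t - i) j.succ)) + u t

theorem _root_.RegCoint.colCons_mulVec {m : Type*} {d : ℕ} (v : m → ℝ) (A : Matrix m (Fin d) ℝ)
    (w : Fin (d + 1) → ℝ) : colCons v A *ᵥ w = w 0 • v + A *ᵥ (fun j => w j.succ) := by
  ext a
  simp [colCons, Matrix.mulVec, dotProduct, Fin.sum_univ_succ, mul_comm]

/-- Since y = y⁺ + y⁻, the nonlinearity can be confined to a multiple of y⁻. -/
theorem regime_sum_eq (i : ℕ) (w : Fin (d + 1) → ℝ) :
    max (w 0) 0 • M.phi .pos i + min (w 0) 0 • M.phi .neg i + M.PhiX i *ᵥ (fun j => w j.succ) =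
      M.Phi .pos i *ᵥ w + min (w 0) 0 • M.phiDiff i := by
  rw [Phi, colCons_mulVec, phiDiff]
  have : w 0 = max (w 0) 0 + min (w 0) 0 := by rw [max_add_min, add_zero]
  have h2 : w 0 • M.phi .pos i = max (w 0) 0 • M.phi .pos i + min (w 0) 0 • M.phi .pos i := by
    rw [← add_smul, ← this]
  rw [h2, smul_sub]
  abel

theorem piMat_eq (s : Regime) : M.PiMat s = -(1 - ∑ i ∈ Finset.Icc 1 (l + 2), M.Phi s i) := by
  ext a b
  refine Fin.cases ?_ (fun b => ?_) b
  · simp [PiMat, colCons, pi, Phi, Matrix.sum_apply, Matrix.one_apply, Pi.single_apply]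
  · simp [PiMat, colCons, PiX, Phi, Matrix.sum_apply]
    rfl

/-- Summation by parts, by induction on the number of lags: a new top lag changes every earlier
difference coefficient by the same matrix, and the differences it multiplies telescope. -/
theorem _root_.RegCoint.sum_mulVec_lags {m : Type*} [Fintype m] (A : ℕ → Matrix m m ℝ)
    (x : ℤ → m → ℝ) (t : ℤ) (K : ℕ) :
    ∑ i ∈ Finset.Icc 1 (K + 1), A i *ᵥ x (t + 1 - i) =
      (∑ i ∈ Finset.Icc 1 (K + 1), A i) *ᵥ x t +
        ∑ j ∈ Finset.range K, (-∑ i ∈ Finset.Icc (j + 1 + 1) (K + 1), A i) *ᵥ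
          (x (t - j) - x (t - j - 1)) := by
  induction K with
  | zero => simp
  | succ K ih =>
    have h0 : ∑ i ∈ Finset.Icc 1 (K + 1 + 1), A i =
        ∑ i ∈ Finset.Icc 1 (K + 1), A i + A (K + 1 + 1) := Finset.sum_Icc_succ_top (by omega) A
    rw [Finset.sum_Icc_succ_top (by omega), ih, h0, Finset.sum_range_succ, Matrix.add_mulVec]
    have h1 : ∑ j ∈ Finset.range K, (-∑ i ∈ Finset.Icc (j + 1 + 1) (K + 1 + 1), A i) *ᵥ
        (x (t - j) - x (t - j - 1)) =
        ∑ j ∈ Finset.range K, (-∑ i ∈ Finset.Icc (j + 1 + 1) (K + 1), A i) *ᵥ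
          (x (t - j) - x (t - j - 1)) - A (K + 1 + 1) *ᵥ (x t - x (t - K)) := by
      have h2 : ∑ j ∈ Finset.range K, (x (t - j) - x (t - j - 1)) = x t - x (t - K) := by
        have := Finset.sum_range_sub' (fun j : ℕ => x (t - j)) K
        simp only [Nat.cast_zero, sub_zero, Nat.cast_add, Nat.cast_one] at this
        rw [← this]
        simp only [sub_sub]
      rw [← h2, Matrix.mulVec_sum, ← Finset.sum_sub_distrib]
      refine Finset.sum_congr rfl fun j hj => ?_
      rw [Finset.sum_Icc_succ_top (by have := Finset.mem_range.1 hj; omega), neg_add,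
        Matrix.add_mulVec, Matrix.neg_mulVec (x (t - j) - x (t - j - 1)) (A (K + 1 + 1))]
      abel
    rw [h1]
    have h3 : t + 1 - ((K + 1 + 1 : ℕ) : ℤ) = t - K - 1 := by push_cast; ring
    rw [h3]
    simp only [Finset.Icc_self, Finset.sum_singleton, Matrix.neg_mulVec, Matrix.mulVec_sub]
    abel

variable {M} in
/-- The error-correction form of the model. -/
theorem IsPath.errorCorrection {u : ℕ → Fin (d + 1) → ℝ} {z : ℤ → Fin (d + 1) → ℝ}
    (h : M.IsPath u z) (t : ℕ) :
    z (t + 1) - z t = M.PiMat .pos *ᵥ z t +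
      ∑ m ∈ Finset.range (l + 1), M.Gamma .pos (m + 1) *ᵥ (z (t - m) - z (t - m - 1)) +
      ∑ i ∈ Finset.Icc 1 (l + 2), min (z (t + 1 - i) 0) 0 • M.phiDiff i + (M.c + u (t + 1)) := by
  have h1 := h (t + 1) (by omega)
  simp only [M.regime_sum_eq, Finset.sum_add_distrib] at h1
  push_cast at h1
  have h2 := sum_mulVec_lags (M.Phi .pos) z t (l + 1)
  rw [h2] at h1
  rw [h1, piMat_eq, Matrix.neg_mulVec, Matrix.sub_mulVec, Matrix.one_mulVec]
  simp only [Gamma]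
  abel

/-! ### The companion form of the short-memory components -/

section Companion

variable {r : ℕ} (α β : Matrix (Fin (d + 1)) (Fin r) ℝ)

/-- The equilibrium errors and the differences. -/
def shortMemory (l : ℕ) (z : ℤ → Fin (d + 1) → ℝ) (t : ℤ) :
    Fin r ⊕ Fin (l + 1) × Fin (d + 1) → ℝ :=
  Sum.elim (βᵀ *ᵥ z t) (fun ma => z (t - (ma.1 : ℕ)) ma.2 - z (t - (ma.1 : ℕ) - 1) ma.2)

/-- The state vector of the companion form. -/
def state (l : ℕ) (z : ℤ → Fin (d + 1) → ℝ) (t : ℤ) :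
    (Fin r ⊕ Fin (l + 1) × Fin (d + 1)) ⊕ (Unit ⊕ Fin (l + 1)) → ℝ :=
  Sum.elim (shortMemory β l z t)
    (Sum.elim (fun _ => z t 0 - max (z (t - 1) 0) 0) (fun i => min (z (t - 1 - (i : ℕ)) 0) 0))

/-- The vector `(z_t, …, z_{t-k+1})`. -/
def stack (l : ℕ) (z : ℤ → Fin (d + 1) → ℝ) (t : ℤ) : Fin (l + 2) × Fin (d + 1) → ℝ :=
  fun ja => z (t - (ja.1 : ℕ)) ja.2

theorem boldBetaT_mulVec_stack (z : ℤ → Fin (d + 1) → ℝ) (t : ℤ) :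
    boldBetaT (l := l) β *ᵥ stack l z t = shortMemory β l z t := by
  ext i
  rcases i with b | ⟨m, a⟩
  · simp [boldBetaT, stack, shortMemory, Matrix.mulVec, dotProduct, Fintype.sum_prod_type,
      ite_mul, Fin.sum_univ_succ (n := l + 1), Fin.succ_ne_zero]
  · have h1 : ∀ (j : Fin (l + 2)) (a' : Fin (d + 1)),
        boldBetaT (l := l) β (Sum.inr (m, a)) (j, a') =
        (if j = m.castSucc then (1 : Matrix (Fin (d + 1)) (Fin (d + 1)) ℝ) a a' else 0) -
        (if j = m.succ then (1 : Matrix (Fin (d + 1)) (Fin (d + 1)) ℝ) a a' else 0) := by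
      intro j a'
      have := Fin.castSucc_lt_succ (i := m)
      by_cases h1 : j = m.castSucc
      · simp [boldBetaT, h1, this.ne]
      · simp only [boldBetaT, Matrix.of_apply, Sum.elim_inr, h1, if_false, zero_sub]
        split_ifs <;> simp
    simp only [Matrix.mulVec, dotProduct, Fintype.sum_prod_type, h1, sub_mul, ite_mul, zero_mul,
      Finset.sum_sub_distrib, Matrix.one_apply]
    rw [Finset.sum_comm]
    conv_lhs => enter [2]; rw [Finset.sum_comm]
    simp [stack, shortMemory, sub_sub]

theorem boldBetaT_mulVec_top (g : Fin (d + 1) → ℝ) :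
    boldBetaT (l := l) β *ᵥ (fun ja => if ja.1 = 0 then g ja.2 else 0) =
      boldBetaTopT (l := l) β *ᵥ g := by
  ext i
  simp [boldBetaTopT, Matrix.mulVec, dotProduct, Fintype.sum_prod_type,
    Fin.sum_univ_succ (n := l + 1), Fin.succ_ne_zero]

theorem boldAlpha_mulVec_zero (z : ℤ → Fin (d + 1) → ℝ) (t : ℤ) (a : Fin (d + 1)) :
    (M.boldAlpha α *ᵥ shortMemory β l z t) (0, a) =
      ((α * βᵀ) *ᵥ z t + ∑ m ∈ Finset.range (l + 1),
        M.Gamma .pos (m + 1) *ᵥ (z (t - m) - z (t - m - 1))) a := by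
  rw [← Matrix.mulVec_mulVec, Finset.sum_range]
  simp [boldAlpha, shortMemory, Matrix.mulVec, dotProduct, Fintype.sum_prod_type, Finset.sum_apply,
    -Matrix.mulVec_mulVec]

theorem boldAlpha_mulVec_succ (z : ℤ → Fin (d + 1) → ℝ) (t : ℤ) (j : Fin (l + 1))
    (a : Fin (d + 1)) : (M.boldAlpha α *ᵥ shortMemory β l z t) (j.succ, a) =
      z (t - (j : ℕ)) a - z (t - (j : ℕ) - 1) a := by
  simp only [boldAlpha, Matrix.mulVec, dotProduct, Fintype.sum_sum_type, Matrix.of_apply,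
    Fin.succ_ne_zero, if_false, Sum.elim_inl, Sum.elim_inr, zero_mul, Finset.sum_const_zero,
    zero_add, Fintype.sum_prod_type, Fin.succ_inj, ite_mul, Matrix.one_apply]
  rw [Finset.sum_comm]
  simp [shortMemory]

/-- If b < 0 then b - a⁺ ≤ b < 0, so the ratio of b to b - a⁺ is in [0,1]. With a = y_{t-1} and b =
y_t this makes y_t⁻ a fraction of the auxiliary coordinate of `state`, so that both regimes fit one
family of matrices. -/
theorem _root_.RegCoint.exists_regime_weight (a b : ℝ) :
    ∃ δ : ℝ, 0 ≤ δ ∧ δ ≤ 1 ∧ min b 0 = δ * (b - max a 0) := by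
  rcases le_total 0 b with hb | hb
  · exact ⟨0, le_rfl, zero_le_one, by simp [hb]⟩
  · have h1 : b - max a 0 ≤ b := by linarith [le_max_right a 0]
    rcases hb.eq_or_lt with rfl | hb'
    · exact ⟨0, le_rfl, zero_le_one, by simp⟩
    · have h2 : b - max a 0 < 0 := by linarith
      refine ⟨b / (b - max a 0), div_nonneg_of_nonpos hb h2.le, ?_, ?_⟩
      · rw [div_le_one_of_neg h2]; exact h1
      · rw [div_mul_cancel₀ _ h2.ne, min_eq_left hb]

/-- The effect of the shocks on the state vector. -/
def shockMap (l : ℕ) : (Fin (d + 1) → ℝ) →ₗ[ℝ]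
    ((Fin r ⊕ Fin (l + 1) × Fin (d + 1)) ⊕ (Unit ⊕ Fin (l + 1)) → ℝ) where
  toFun w := Sum.elim (boldBetaTopT (l := l) β *ᵥ w) (Sum.elim (fun _ => w 0) (fun _ => 0))
  map_add' v w := by
    ext i; rcases i with i | i | i <;> simp [Matrix.mulVec_add]
  map_smul' c w := by
    ext i; rcases i with i | i | i <;> simp [Matrix.mulVec_smul]

variable {M α β} in
-- The stacked levels move by `boldAlpha` times the short-memory vector, plus an input in the first
-- block only; `boldBetaT` then turns levels into short-memory components.
theorem IsPath.shortMemory_succ {u : ℕ → Fin (d + 1) → ℝ} {z : ℤ → Fin (d + 1) → ℝ}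
    (h : M.IsPath u z) (hαβ : M.PiMat .pos = α * βᵀ) (t : ℕ) :
    shortMemory β l z (t + 1) = (1 + boldBetaT (l := l) β * M.boldAlpha α) *ᵥ shortMemory β l z t +
      boldBetaTopT (l := l) β *ᵥ (∑ i ∈ Finset.Icc 1 (l + 2),
        min (z (t + 1 - i) 0) 0 • M.phiDiff i + (M.c + u (t + 1))) := by
  have h1 := h.errorCorrection t
  rw [hαβ] at h1
  have h2 : stack l z (t + 1) = stack l z t + M.boldAlpha α *ᵥ shortMemory β l z t +
      (fun ja => if ja.1 = 0 then (∑ i ∈ Finset.Icc 1 (l + 2),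
        min (z (t + 1 - i) 0) 0 • M.phiDiff i + (M.c + u (t + 1))) ja.2 else 0) := by
    ext ⟨j, a⟩
    refine Fin.cases ?_ (fun j => ?_) j
    · simp only [Pi.add_apply, boldAlpha_mulVec_zero]
      have h3 := congrFun h1 a
      simp only [Pi.sub_apply, Pi.add_apply] at h3
      simp only [stack, Fin.val_zero, Nat.cast_zero, sub_zero, if_true]
      linarith
    · simp only [Pi.add_apply, boldAlpha_mulVec_succ]
      simp only [stack, Fin.val_succ, Fin.succ_ne_zero, if_false, add_zero]
      push_cast
      have h3 : (t : ℤ) + 1 - ((j : ℕ) + 1 : ℤ) = t - (j : ℕ) := by ring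
      have h4 : (t : ℤ) - ((j : ℕ) + 1 : ℤ) = t - (j : ℕ) - 1 := by ring
      rw [h3, h4]
      ring
  rw [← boldBetaT_mulVec_stack, h2, Matrix.mulVec_add, Matrix.mulVec_add, boldBetaT_mulVec_top,
    boldBetaT_mulVec_stack, Matrix.add_mulVec, Matrix.one_mulVec, Matrix.mulVec_mulVec]

variable {M α β} in
-- Of the negative parts entering at time t + 1, only y_t⁻ is not yet a coordinate of the state; it
-- enters as δ times y_t - y_{t-1}⁺. The older ones are stored and shifted.
theorem IsPath.state_succ {u : ℕ → Fin (d + 1) → ℝ} {z : ℤ → Fin (d + 1) → ℝ}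
    (h : M.IsPath u z) (hαβ : M.PiMat .pos = α * βᵀ) (t : ℕ) :
    ∃ δ : ℝ, 0 ≤ δ ∧ δ ≤ 1 ∧ state β l z (t + 1) =
      M.F α β δ *ᵥ state β l z t + shockMap β l (M.c + u (t + 1)) := by
  obtain ⟨δ, h0, h1, hδ⟩ := exists_regime_weight (z (t - 1) 0) (z t 0)
  refine ⟨δ, h0, h1, ?_⟩
  have hsum : ∑ i ∈ Finset.Icc 1 (l + 2), min (z (t + 1 - i) 0) 0 • M.phiDiff i =
      (δ * (z t 0 - max (z (t - 1) 0) 0)) • M.phiDiff 1 +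
        ∑ i : Fin (l + 1), min (z (t - 1 - (i : ℕ)) 0) 0 • M.phiDiff (i + 2) := by
    rw [← Finset.Ico_add_one_right_eq_Icc, Finset.sum_Ico_eq_sum_range,
      show l + 2 + 1 - 1 = l + 1 + 1 by omega, Finset.sum_range_succ', ← hδ,
      Finset.sum_range]
    refine (add_comm _ _).trans ?_
    congr 1
    · simp
    · refine Finset.sum_congr rfl fun i _ => ?_
      have h3 : (t : ℤ) + 1 - ((1 + ((i : ℕ) + 1) : ℕ) : ℤ) = t - 1 - (i : ℕ) := by
        push_cast; ring
      rw [h3, show 1 + ((i : ℕ) + 1) = i + 2 by omega]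
  have hec := h.errorCorrection t
  rw [hαβ, hsum] at hec
  have hsm := h.shortMemory_succ hαβ t
  rw [hsum] at hsm
  rw [F, state, state, Matrix.fromBlocks_mulVec, Matrix.fromBlocks_mulVec]
  ext i
  rcases i with i | i | i
  · rw [hsm]
    simp only [Sum.elim_inl, Pi.add_apply, shockMap, LinearMap.coe_mk, AddHom.coe_mk,
      Sum.elim_comp_inl, Sum.elim_comp_inr, add_assoc, Matrix.mulVec_add, add_right_inj]
    rw [← add_assoc]
    congr 1
    simp only [Matrix.mulVec, dotProduct, Matrix.of_apply, Fintype.sum_sum_type, Sum.elim_inl,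
      Sum.elim_inr, Finset.univ_unique, Finset.sum_singleton]
    congr 1
    · simp only [Pi.smul_apply, smul_eq_mul, Finset.sum_mul]
      refine Finset.sum_congr rfl fun a _ => ?_
      ring
    · simp only [Finset.sum_apply, Pi.smul_apply, smul_eq_mul, Finset.sum_mul, Finset.mul_sum]
      rw [Finset.sum_comm]
      refine Finset.sum_congr rfl fun a _ => Finset.sum_congr rfl fun b _ => ?_
      ring
  · have h3 := congrFun hec 0
    have h4 := M.boldAlpha_mulVec_zero α β z t 0
    simp only [Pi.sub_apply, Pi.add_apply] at h3 h4
    rw [← h4] at h3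
    have h5 : z t 0 = max (z t 0) 0 + min (z t 0) 0 := by rw [max_add_min, add_zero]
    simp only [Sum.elim_inr, Sum.elim_inl, Pi.add_apply, shockMap, LinearMap.coe_mk,
      AddHom.coe_mk, Sum.elim_comp_inl, Sum.elim_comp_inr, add_sub_cancel_right]
    have h6 : (Matrix.of (Sum.elim (fun (_ : Unit) => M.boldAlpha α (0, 0))
        (fun (_ : Fin (l + 1)) => 0)) *ᵥ shortMemory β l z t) (Sum.inl i) =
        (M.boldAlpha α *ᵥ shortMemory β l z t) (0, 0) := rfl
    rw [h6]
    have h7 : (∑ i : Fin (l + 1), min (z (t - 1 - (i : ℕ)) 0) 0 • M.phiDiff (i + 2)) 0 =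
        ((Matrix.of fun (_ : Unit) (i : Fin (l + 1)) => M.phiDiff ((i : ℕ) + 2) 0) *ᵥ
          fun i : Fin (l + 1) => min (z (t - 1 - (i : ℕ)) 0) 0) i := by
      simp [Matrix.mulVec, dotProduct, mul_comm]
    rw [h7] at h3
    simp only [Matrix.mulVec, dotProduct, Matrix.of_apply, Finset.univ_unique,
      Finset.sum_singleton, Pi.smul_apply, smul_eq_mul] at h3 ⊢
    linarith
  · simp only [Sum.elim_inr, Pi.add_apply, shockMap, LinearMap.coe_mk,
      AddHom.coe_mk, Sum.elim_comp_inl, Sum.elim_comp_inr, add_sub_cancel_right, add_zero]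
    have h6 : (Matrix.of (Sum.elim (fun (_ : Unit) => M.boldAlpha α (0, 0))
        (fun (_ : Fin (l + 1)) => 0)) *ᵥ shortMemory β l z t) (Sum.inr i) = 0 := by
      simp [Matrix.mulVec]
    rw [h6, zero_add]
    simp only [Matrix.mulVec, dotProduct, Matrix.of_apply, Finset.univ_unique,
      Finset.sum_singleton]
    refine Fin.cases ?_ (fun i => ?_) i
    · simp [hδ]
    · have h8 : ∀ j : Fin (l + 1), (if ((i.succ : Fin (l + 1)) : ℕ) = j + 1 then (1 : ℝ) else 0) =
          if i.castSucc = j then 1 else 0 := by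
        intro j
        simp [Fin.ext_iff]
      simp only [h8]
      simp only [Fin.succ_ne_zero, if_false, zero_mul, zero_add, ite_mul, one_mul,
        Finset.sum_ite_eq, Finset.mem_univ, if_true, Fin.val_succ, Fin.val_castSucc]
      have h9 : (t : ℤ) + 1 - 1 - ((i : ℕ) + 1 : ℕ) = t - 1 - (i : ℕ) := by push_cast; ring
      rw [← h9, add_sub_cancel_right]

/-- Extends a contraction common to the two extreme matrices to all weights in [0,1], by convexity.
-/
theorem F_eq (δ : ℝ) : M.F α β δ = (1 - δ) • M.F α β 0 + δ • M.F α β 1 := by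
  ext i j
  rcases i with i | i | i <;> rcases j with j | j | j <;>
    simp [F, Matrix.fromBlocks] <;> try ring1
  · split_ifs <;> ring

end Companion

end CKSVAR

namespace CKSVAR

variable {d l : ℕ} {M : CKSVAR d l} {r : ℕ} {α β : Matrix (Fin (d + 1)) (Fin r) ℝ}

/-! ### Pathwise bounds for the short-memory components -/

/-- The shocks up to time `n`, and the short-memory components of the initial values, are bounded
by `B`. -/
structure InputBound (l : ℕ) (β : Matrix (Fin (d + 1)) (Fin r) ℝ) (u : ℕ → Fin (d + 1) → ℝ)
    (z : ℤ → Fin (d + 1) → ℝ) (n : ℕ) (B : ℝ) : Prop where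
  one_le : 1 ≤ B
  shock : ∀ t, 1 ≤ t → t ≤ n → ‖u t‖ ≤ B
  eqErr : ‖βᵀ *ᵥ z 0‖ ≤ B
  diff : ∀ t : ℤ, -(l : ℤ) ≤ t → t ≤ 0 → ‖z t - z (t - 1)‖ ≤ B
  neg : ∀ t : ℤ, -(l + 1 : ℤ) ≤ t → t ≤ 0 → |min (z t 0) 0| ≤ B

theorem InputBound.norm_state_zero_le {u : ℕ → Fin (d + 1) → ℝ} {z : ℤ → Fin (d + 1) → ℝ} {n : ℕ}
    {B : ℝ} (hB : InputBound l β u z n B) : ‖state β l z 0‖ ≤ 2 * B := by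
  have hB0 : 0 ≤ B := zero_le_one.trans hB.one_le
  rw [pi_norm_le_iff_of_nonneg (by positivity)]
  rintro ((b | ⟨m, a⟩) | _ | i)
  · have := (norm_le_pi_norm (βᵀ *ᵥ z 0) b).trans hB.eqErr
    simp only [state, shortMemory, Sum.elim_inl]
    linarith
  · have h1 := hB.diff (0 - (m : ℕ)) (by omega) (by omega)
    have h2 := (norm_le_pi_norm _ a).trans h1
    simp only [Pi.sub_apply] at h2
    simp only [state, shortMemory, Sum.elim_inl, Sum.elim_inr]
    linarith
  · have h1 := (norm_le_pi_norm _ 0).trans (hB.diff 0 (by omega) le_rfl)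
    have h2 := hB.neg (0 - 1) (by omega) (by omega)
    -- The auxiliary coordinate at time 0 is Δy₀ + y₋₁⁻, two terms of size B; hence the factor 2.
    have h3 : z 0 0 - max (z (0 - 1) 0) 0 = (z 0 0 - z (0 - 1) 0) + min (z (0 - 1) 0) 0 := by
      have := max_add_min (z (0 - 1) 0) 0
      linarith
    simp only [state, Sum.elim_inr, Sum.elim_inl, h3]
    refine (norm_add_le _ _).trans ?_
    rw [Real.norm_eq_abs (min _ _)]
    simp only [Pi.sub_apply] at h1
    linarith
  · have h2 := hB.neg (0 - 1 - (i : ℕ)) (by omega) (by omega)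
    simp only [state, Sum.elim_inr, Real.norm_eq_abs]
    linarith

/-- In the contracted norm, p(state) at time t + 1 is at most θ times its value at t plus GB, where
1 ≤ B lets G absorb the intercept. The bound DB propagates because D(1 - θ) ≥ G, and the extra 2K in
D covers the initial state. -/
theorem exists_norm_state_le (hαβ : M.PiMat .pos = α * βᵀ)
    (hjsr : jointSpectralRadius {M.F α β 0, M.F α β 1} < 1) :
    ∃ C : ℝ, 0 ≤ C ∧ ∀ (u : ℕ → Fin (d + 1) → ℝ) (z : ℤ → Fin (d + 1) → ℝ) (n : ℕ) (B : ℝ),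
      M.IsPath u z → InputBound l β u z n B → ∀ t : ℕ, t ≤ n → ‖state β l z t‖ ≤ C * B := by
  obtain ⟨p, θ, K, hθ, hθ1, hK, hKp, hpK, hp⟩ :=
    exists_contracting_seminorm (Set.toFinite _) hjsr
  have hF : ∀ δ : ℝ, 0 ≤ δ → δ ≤ 1 → ∀ v, p (M.F α β δ *ᵥ v) ≤ θ * p v := by
    intro δ h0 h1 v
    rw [F_eq, Matrix.add_mulVec, Matrix.smul_mulVec, Matrix.smul_mulVec]
    have h2 := hp (M.F α β 0) (by simp) v
    have h3 := hp (M.F α β 1) (by simp) v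
    refine (map_add_le_add p _ _).trans ?_
    rw [map_smul_eq_mul, map_smul_eq_mul, Real.norm_of_nonneg h0, Real.norm_of_nonneg (by linarith)]
    calc (1 - δ) * p (M.F α β 0 *ᵥ v) + δ * p (M.F α β 1 *ᵥ v)
        ≤ (1 - δ) * (θ * p v) + δ * (θ * p v) := by gcongr
      _ = θ * p v := by ring
  let s := LinearMap.toContinuousLinearMap (shockMap β l)
  let G := K * (‖s‖ * (‖M.c‖ + 1))
  have hG : 0 ≤ G := by positivity
  let D := (2 * K + G) / (1 - θ)
  have hD : D * (1 - θ) = 2 * K + G := div_mul_cancel₀ _ (by linarith)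
  have hD0 : 0 ≤ D := div_nonneg (by positivity) (by linarith)
  refine ⟨K * D, by positivity, fun u z n B hz hB => ?_⟩
  have hB0 : 0 ≤ B := zero_le_one.trans hB.one_le
  have key : ∀ t : ℕ, t ≤ n → p (state β l z t) ≤ D * B := by
    intro t
    induction t with
    | zero =>
      intro _
      have h1 : p (state β l z 0) ≤ K * (2 * B) := (hpK _).trans (by
        gcongr
        exact hB.norm_state_zero_le)
      have h2 : 2 * K ≤ D := by nlinarith
      rw [Nat.cast_zero]
      nlinarith
    | succ t ih =>
      intro ht
      obtain ⟨δ, h0, h1, hst⟩ := hz.state_succ hαβ t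
      push_cast
      rw [hst]
      have h2 : ‖M.c + u (t + 1)‖ ≤ (‖M.c‖ + 1) * B := by
        have := hB.shock (t + 1) (by omega) ht
        refine (norm_add_le _ _).trans ?_
        nlinarith [norm_nonneg M.c, hB.one_le]
      have h3 : p (shockMap β l (M.c + u (t + 1))) ≤ G * B := by
        refine (hpK _).trans ?_
        have h4 : ‖shockMap β l (M.c + u (t + 1))‖ ≤ ‖s‖ * ((‖M.c‖ + 1) * B) :=
          (s.le_opNorm _).trans (by gcongr)
        calc K * ‖shockMap β l (M.c + u (t + 1))‖ ≤ K * (‖s‖ * ((‖M.c‖ + 1) * B)) := by gcongr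
          _ = G * B := by simp only [G]; ring
      calc p (M.F α β δ *ᵥ state β l z t + shockMap β l (M.c + u (t + 1)))
          ≤ θ * (D * B) + G * B := (map_add_le_add p _ _).trans (add_le_add
            ((hF δ h0 h1 _).trans (by gcongr; exact ih (by omega))) h3)
        _ = (θ * D + G) * B := by ring
        _ ≤ D * B := by
          gcongr
          nlinarith
  intro t ht
  refine (hKp _).trans ?_
  rw [mul_assoc]
  gcongr
  exact key t ht

/-- The short-memory components are bounded by `B` up to time `n`. -/
structure ShortMemoryBound (l : ℕ) (β : Matrix (Fin (d + 1)) (Fin r) ℝ)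
    (z : ℤ → Fin (d + 1) → ℝ) (n : ℕ) (B : ℝ) : Prop where
  eqErr : ∀ t : ℕ, t ≤ n → ‖βᵀ *ᵥ z t‖ ≤ B
  diff : ∀ t : ℤ, -(l : ℤ) ≤ t → t ≤ n → ‖z t - z (t - 1)‖ ≤ B
  neg : ∀ t : ℤ, -(l + 1 : ℤ) ≤ t → t ≤ n → |min (z t 0) 0| ≤ B

/-- For t > 0 each component is a coordinate of the state, or a fraction δ ≤ 1 of one in the case of
y_t⁻. The extra 1 in the constant covers the times t ≤ 0, where the input bound applies directly. -/
theorem exists_shortMemoryBound (hαβ : M.PiMat .pos = α * βᵀ)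
    (hjsr : jointSpectralRadius {M.F α β 0, M.F α β 1} < 1) :
    ∃ C : ℝ, 0 ≤ C ∧ ∀ (u : ℕ → Fin (d + 1) → ℝ) (z : ℤ → Fin (d + 1) → ℝ) (n : ℕ) (B : ℝ),
      M.IsPath u z → InputBound l β u z n B → ShortMemoryBound l β z n (C * B) := by
  obtain ⟨C, hC, h⟩ := exists_norm_state_le hαβ hjsr
  refine ⟨C + 1, by positivity, fun u z n B hz hB => ?_⟩
  have hB0 : 0 ≤ B := zero_le_one.trans hB.one_le
  have hst : ∀ t : ℕ, t ≤ n → ∀ i, ‖state β l z t i‖ ≤ C * B := fun t ht i =>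
    (norm_le_pi_norm _ i).trans (h u z n B hz hB t ht)
  have hCB : C * B ≤ (C + 1) * B := by nlinarith
  have hCB' : B ≤ (C + 1) * B := by nlinarith [mul_nonneg hC hB0]
  have h0 : 0 ≤ (C + 1) * B := by positivity
  refine ⟨fun t ht => ?_, fun t ht ht' => ?_, fun t ht ht' => ?_⟩
  · rw [pi_norm_le_iff_of_nonneg h0]
    intro b
    exact (hst t ht (Sum.inl (Sum.inl b))).trans hCB
  · rcases le_or_gt t 0 with h1 | h1
    · exact (hB.diff t ht h1).trans hCB'
    · obtain ⟨t, rfl⟩ := Int.eq_ofNat_of_zero_le h1.le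
      rw [pi_norm_le_iff_of_nonneg h0]
      intro a
      have h2 := hst t (by exact_mod_cast ht') (Sum.inl (Sum.inr (0, a)))
      simp only [state, shortMemory, Sum.elim_inl, Sum.elim_inr, Fin.val_zero, Nat.cast_zero,
        sub_zero] at h2
      exact h2.trans hCB
  · rcases le_or_gt t 0 with h1 | h1
    · exact (hB.neg t ht h1).trans hCB'
    · obtain ⟨t, rfl⟩ := Int.eq_ofNat_of_zero_le h1.le
      have h2 := hst t (by exact_mod_cast ht') (Sum.inr (Sum.inl ()))
      obtain ⟨δ, hδ0, hδ1, hδ⟩ := exists_regime_weight (z (t - 1) 0) (z t 0)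
      simp only [state, Sum.elim_inl, Sum.elim_inr] at h2
      change |min (z (t : ℤ) 0) 0| ≤ _
      rw [hδ, abs_mul, abs_of_nonneg hδ0]
      rw [Real.norm_eq_abs] at h2
      nlinarith [abs_nonneg (z t 0 - max (z (t - 1) 0) 0)]

end CKSVAR

/-! ### Orthocomplements and matrices of full column rank. -/

/-- An orthocomplement spans the kernel of the transpose. -/
theorem IsOrthocomplement.exists_mulVec_eq {m n q : ℕ} {A : Matrix (Fin m) (Fin n) ℝ}
    {B : Matrix (Fin m) (Fin q) ℝ} (h : IsOrthocomplement A B) (hA : A.rank = n)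
    {x : Fin m → ℝ} (hx : Aᵀ *ᵥ x = 0) : ∃ w, B *ᵥ w = x := by
  obtain ⟨hnq, hB, hBA⟩ := h
  have hAB : Aᵀ * B = 0 := by
    have := congrArg Matrix.transpose hBA
    simpa using this
  have hle : LinearMap.range B.mulVecLin ≤ LinearMap.ker Aᵀ.mulVecLin := by
    rintro _ ⟨w, rfl⟩
    rw [LinearMap.mem_ker, Matrix.mulVecLin_apply, Matrix.mulVecLin_apply, Matrix.mulVec_mulVec,
      hAB, Matrix.zero_mulVec]
  have h1 : Module.finrank ℝ (LinearMap.range B.mulVecLin) = q := hB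
  have h2 : Module.finrank ℝ (LinearMap.range Aᵀ.mulVecLin) = n := by
    exact (Matrix.rank_transpose A).trans hA
  have h3 := LinearMap.finrank_range_add_finrank_ker Aᵀ.mulVecLin
  rw [h2, Module.finrank_fin_fun] at h3
  have h4 := Submodule.eq_of_le_of_finrank_eq hle (by omega)
  have h5 : x ∈ LinearMap.ker Aᵀ.mulVecLin := hx
  rw [← h4] at h5
  exact h5

theorem transpose_mulVec_surjective {m n : ℕ} {A : Matrix (Fin m) (Fin n) ℝ} (hA : A.rank = n) :
    Function.Surjective Aᵀ.mulVecLin := by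
  rw [← LinearMap.range_eq_top]
  apply Submodule.eq_top_of_finrank_eq
  rw [Module.finrank_fin_fun]
  change Aᵀ.rank = n
  rw [Matrix.rank_transpose, hA]

theorem mulVec_injective_of_rank {m n : ℕ} {A : Matrix (Fin m) (Fin n) ℝ} (hA : A.rank = n) :
    Function.Injective A.mulVec := by
  have h3 := LinearMap.finrank_range_add_finrank_ker A.mulVecLin
  have h2 : Module.finrank ℝ (LinearMap.range A.mulVecLin) = n := hA
  rw [h2, Module.finrank_fin_fun] at h3
  have h4 : LinearMap.ker A.mulVecLin = ⊥ := Submodule.finrank_eq_zero.1 (by omega)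
  exact LinearMap.ker_eq_bot.1 h4

namespace CKSVAR

variable {d l : ℕ} {M : CKSVAR d l} {r q : ℕ} {α β : Matrix (Fin (d + 1)) (Fin r) ℝ}
  {αp βp : Matrix (Fin (d + 1)) (Fin q) ℝ}

/-! ### The projection on the common trends -/

/-- The inverse of a singular matrix is 0 by convention, so singularity would make P and with it κ
vanish. Invertibility thus follows from κ₁ ≠ 0 alone. -/
theorem isUnit_det_of_kappa_ne_zero (hκ : M.kappa αp βp 0 ≠ 0) :
    IsUnit (αpᵀ * M.GammaOne .pos * βp).det := by
  by_contra h
  apply hκ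
  rw [kappa, proj, Matrix.nonsing_inv_apply_not_isUnit _ h]
  simp

theorem proj_mul_alpha (hαp : IsOrthocomplement α αp) : M.proj αp βp * α = 0 := by
  rw [proj, Matrix.mul_assoc, hαp.2.2, Matrix.mul_zero]

theorem proj_mul_gammaOne_mul (hκ : M.kappa αp βp 0 ≠ 0) :
    M.proj αp βp * M.GammaOne .pos * βp = βp := by
  have h := isUnit_det_of_kappa_ne_zero hκ
  rw [proj]
  simp only [Matrix.mul_assoc]
  rw [← Matrix.mul_assoc αpᵀ, Matrix.nonsing_inv_mul _ h, Matrix.mul_one]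

theorem proj_mulVec_gammaOne_mulVec (hκ : M.kappa αp βp 0 ≠ 0) (hβ : β.rank = r)
    (hβp : IsOrthocomplement β βp) {x : Fin (d + 1) → ℝ} (hx : βᵀ *ᵥ x = 0) :
    M.proj αp βp *ᵥ M.GammaOne .pos *ᵥ x = x := by
  obtain ⟨w, rfl⟩ := hβp.exists_mulVec_eq hβ hx
  rw [Matrix.mulVec_mulVec, Matrix.mulVec_mulVec, proj_mul_gammaOne_mul hκ]

theorem proj_mulVec_piMat (hαβ : M.PiMat .pos = α * βᵀ) (hαp : IsOrthocomplement α αp)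
    (v : Fin (d + 1) → ℝ) : M.proj αp βp *ᵥ M.PiMat .pos *ᵥ v = 0 := by
  rw [hαβ, Matrix.mulVec_mulVec, ← Matrix.mul_assoc, proj_mul_alpha hαp, Matrix.zero_mul,
    Matrix.zero_mulVec]

theorem piMat_mulVec_single (s : Regime) : M.PiMat s *ᵥ Pi.single 0 1 = M.pi s := by
  rw [PiMat, colCons_mulVec]
  have : (fun j : Fin d => (Pi.single 0 1 : Fin (d + 1) → ℝ) j.succ) = 0 := by
    ext j
    simp [Fin.succ_ne_zero]
  rw [this]
  simp

theorem sum_phiDiff : ∑ i ∈ Finset.Icc 1 (l + 2), M.phiDiff i = M.pi .neg - M.pi .pos := by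
  simp [phiDiff, pi, Finset.sum_sub_distrib]

/-- The differences sum to π⁻ - π⁺, and π⁺ = Π⁺e₁ is annihilated by P. -/
theorem proj_mulVec_sum_phiDiff (hαβ : M.PiMat .pos = α * βᵀ) (hαp : IsOrthocomplement α αp) :
    ∑ i ∈ Finset.Icc 1 (l + 2), M.proj αp βp *ᵥ M.phiDiff i = M.kappa αp βp := by
  rw [← Matrix.mulVec_sum, sum_phiDiff, Matrix.mulVec_sub, ← piMat_mulVec_single .pos,
    proj_mulVec_piMat hαβ hαp, sub_zero, kappa]

/-- The map I - PΓ⁺(1) vanishes on ker βᵀ and therefore factors through βᵀ; the constant is the norm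
of the other factor. -/
theorem exists_norm_sub_proj_le (hκ : M.kappa αp βp 0 ≠ 0) (hβ : β.rank = r)
    (hβp : IsOrthocomplement β βp) : ∃ C : ℝ, 0 ≤ C ∧ ∀ x : Fin (d + 1) → ℝ,
      ‖x - M.proj αp βp *ᵥ M.GammaOne .pos *ᵥ x‖ ≤ C * ‖βᵀ *ᵥ x‖ := by
  obtain ⟨s, hs⟩ := βᵀ.mulVecLin.exists_rightInverse_of_surjective
    (LinearMap.range_eq_top.2 (transpose_mulVec_surjective hβ))
  let g := LinearMap.toContinuousLinearMap
    ((LinearMap.id - (M.proj αp βp * M.GammaOne .pos).mulVecLin) ∘ₗ s)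
  refine ⟨‖g‖, norm_nonneg _, fun x => ?_⟩
  have h1 : βᵀ *ᵥ (x - s (βᵀ *ᵥ x)) = 0 := by
    have := LinearMap.congr_fun hs (βᵀ *ᵥ x)
    simp only [LinearMap.comp_apply, Matrix.mulVecLin_apply, LinearMap.id_apply] at this
    rw [Matrix.mulVec_sub, this, sub_self]
  have h2 := proj_mulVec_gammaOne_mulVec (αp := αp) hκ hβ hβp h1
  have h3 : x - M.proj αp βp *ᵥ M.GammaOne .pos *ᵥ x = g (βᵀ *ᵥ x) := by
    simp only [Matrix.mulVec_sub] at h2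
    simp only [g, LinearMap.coe_toContinuousLinearMap', LinearMap.comp_apply, LinearMap.sub_apply,
      LinearMap.id_apply, Matrix.mulVecLin_apply, ← Matrix.mulVec_mulVec]
    rw [sub_eq_sub_iff_add_eq_add] at h2 ⊢
    exact h2.symm.trans (add_comm _ _)
  rw [h3]
  exact g.le_opNorm _

/-! ### The common trends -/

/-- The trend component `P (Γ⁺(1) z₀ + ∑_{s ≤ t} u_s)`. -/
def trend (M : CKSVAR d l) (αp βp : Matrix (Fin (d + 1)) (Fin q) ℝ)
    (u : ℕ → Fin (d + 1) → ℝ) (z₀ : Fin (d + 1) → ℝ) (t : ℕ) : Fin (d + 1) → ℝ :=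
  M.proj αp βp *ᵥ (M.GammaOne .pos *ᵥ z₀ + ∑ s ∈ Finset.Icc 1 t, u s)

/-- P removes the equilibrium correction and the intercept. Summed over time, the lagged differences
collapse to boundary differences, and the i-th lag of y⁻ contributes the common sum of the y_s⁻ up
to i terms at either end. The coefficients of the common sum add up to κ. -/
theorem IsPath.proj_mulVec_eq {u : ℕ → Fin (d + 1) → ℝ} {z : ℤ → Fin (d + 1) → ℝ}
    (hz : M.IsPath u z) (hαβ : M.PiMat .pos = α * βᵀ) (hαp : IsOrthocomplement α αp)
    (hc : ∃ v, M.PiMat .pos *ᵥ v = M.c) (t : ℕ) :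
    M.proj αp βp *ᵥ M.GammaOne .pos *ᵥ z t = M.trend αp βp u (z 0) t +
      (∑ s ∈ Finset.Icc 1 t, min (z s 0) 0) • M.kappa αp βp +
      (∑ m ∈ Finset.range (l + 1), M.proj αp βp *ᵥ M.Gamma .pos (m + 1) *ᵥ
          ((z 0 - z (0 - m - 1)) - (z t - z (t - m - 1))) +
        ∑ i ∈ Finset.Icc 1 (l + 2), (∑ j ∈ Finset.range i,
          (min (z (0 - j) 0) 0 - min (z (t - j) 0) 0)) • M.proj αp βp *ᵥ M.phiDiff i) := by
  induction t with
  | zero => simp [trend]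
  | succ t ih =>
    have h1 := congrArg (M.proj αp βp *ᵥ ·) (hz.errorCorrection t)
    obtain ⟨v, hv⟩ := hc
    simp only [Matrix.mulVec_add, proj_mulVec_piMat hαβ hαp, Matrix.mulVec_sum,
      Matrix.mulVec_smul, zero_add] at h1
    rw [← hv, proj_mulVec_piMat hαβ hαp, zero_add] at h1
    have h2 : M.GammaOne .pos *ᵥ (z (t + 1) - z t) = (z (t + 1) - z t) -
        ∑ m ∈ Finset.range (l + 1), M.Gamma .pos (m + 1) *ᵥ (z (t + 1) - z t) := by
      rw [GammaOne, Matrix.sub_mulVec, Matrix.one_mulVec, ← Finset.Ico_add_one_right_eq_Icc,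
        Finset.sum_Ico_eq_sum_range, Matrix.sum_mulVec]
      simp only [Nat.add_sub_cancel, add_comm 1]
    have h3 : M.trend αp βp u (z 0) (t + 1) = M.trend αp βp u (z 0) t +
        M.proj αp βp *ᵥ u (t + 1) := by
      rw [trend, Finset.sum_Icc_succ_top (by omega), ← add_assoc, Matrix.mulVec_add]
      rfl
    have h4 : ∑ s ∈ Finset.Icc 1 (t + 1), min (z s 0) 0 =
        ∑ s ∈ Finset.Icc 1 t, min (z s 0) 0 + min (z (t + 1) 0) 0 := by
      rw [Finset.sum_Icc_succ_top (by omega)]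
      simp
    have h5 : ∀ i ∈ Finset.Icc 1 (l + 2), (∑ j ∈ Finset.range i,
        (min (z (0 - j) 0) 0 - min (z (t + 1 - j) 0) 0)) • M.proj αp βp *ᵥ M.phiDiff i =
        (∑ j ∈ Finset.range i,
        (min (z (0 - j) 0) 0 - min (z (t - j) 0) 0)) • M.proj αp βp *ᵥ M.phiDiff i +
        min (z (t + 1 - i) 0) 0 • M.proj αp βp *ᵥ M.phiDiff i -
        min (z (t + 1) 0) 0 • M.proj αp βp *ᵥ M.phiDiff i := by
      intro i _
      rw [← add_smul, ← sub_smul]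
      congr 1
      have := Finset.sum_range_sub' (fun j : ℕ => min (z (t + 1 - j) 0) 0) i
      simp only [Nat.cast_add, Nat.cast_one, Nat.cast_zero, sub_zero, add_sub_add_right_eq_sub]
        at this
      rw [add_sub_assoc, ← neg_sub, ← this, ← sub_eq_add_neg, ← Finset.sum_sub_distrib]
      refine Finset.sum_congr rfl fun j _ => ?_
      ring
    have h6 : M.proj αp βp *ᵥ M.GammaOne .pos *ᵥ z (t + 1) =
        M.proj αp βp *ᵥ M.GammaOne .pos *ᵥ z t +
          M.proj αp βp *ᵥ M.GammaOne .pos *ᵥ (z (t + 1) - z t) := by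
      rw [← Matrix.mulVec_add, ← Matrix.mulVec_add]
      congr 2
      abel
    push_cast
    rw [h6, ih, h2, h3, h4, Finset.sum_congr rfl h5, Finset.sum_sub_distrib,
      Finset.sum_add_distrib, ← Finset.smul_sum (r := min (z (t + 1) 0) 0),
      proj_mulVec_sum_phiDiff hαβ hαp, Matrix.mulVec_sub, h1, Matrix.mulVec_sum, add_smul]
    have h7 : ∑ m ∈ Finset.range (l + 1), M.proj αp βp *ᵥ M.Gamma .pos (m + 1) *ᵥ
          ((z 0 - z (0 - m - 1)) - (z (t + 1) - z (t + 1 - m - 1))) =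
        ∑ m ∈ Finset.range (l + 1), M.proj αp βp *ᵥ M.Gamma .pos (m + 1) *ᵥ
          ((z 0 - z (0 - m - 1)) - (z t - z (t - m - 1))) +
        ∑ m ∈ Finset.range (l + 1), M.proj αp βp *ᵥ M.Gamma .pos (m + 1) *ᵥ
          (z (t - m) - z (t - m - 1)) -
        ∑ m ∈ Finset.range (l + 1), M.proj αp βp *ᵥ M.Gamma .pos (m + 1) *ᵥ
          (z (t + 1) - z t) := by
      rw [← Finset.sum_add_distrib, ← Finset.sum_sub_distrib]
      refine Finset.sum_congr rfl fun m _ => ?_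
      rw [← Matrix.mulVec_add, ← Matrix.mulVec_add, ← Matrix.mulVec_sub, ← Matrix.mulVec_sub]
      congr 2
      have : (t : ℤ) + 1 - m - 1 = t - m := by ring
      rw [this]
      abel
    rw [h7]
    abel

end CKSVAR

/-! ### The discrete Skorokhod problem and the pathwise approximation. -/

theorem exists_norm_mulVec_le {m n : ℕ} (A : Matrix (Fin m) (Fin n) ℝ) :
    ∃ C : ℝ, 0 ≤ C ∧ ∀ x, ‖A *ᵥ x‖ ≤ C * ‖x‖ :=
  ⟨‖LinearMap.toContinuousLinearMap A.mulVecLin‖, norm_nonneg _,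
    (LinearMap.toContinuousLinearMap A.mulVecLin).le_opNorm⟩

/-- An approximate solution of the discrete Skorokhod problem is close to the regulator. -/
theorem discrete_skorokhod {y v L : ℕ → ℝ} {κ B : ℝ} {n : ℕ} (hκ : κ ≤ 0) (hB : 0 ≤ B)
    (hy : ∀ t ≤ n, |y t - v t - L t * κ| ≤ B) (hneg : ∀ t ≤ n, -B ≤ y t) (hL0 : L 0 = 0)
    (hL : ∀ t, L (t + 1) = L t + min (y (t + 1)) 0) (t : ℕ) (ht : t ≤ n) :
    (∀ s ≤ t, max (-v s) 0 ≤ L t * κ + 2 * B) ∧ ∃ s ≤ t, L t * κ ≤ max (-v s) 0 + B := by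
  have hmono : Antitone L := antitone_nat_of_succ_le fun t => by
    rw [hL]; linarith [min_le_right (y (t + 1)) 0]
  constructor
  -- As Lκ is nondecreasing, y_s ≥ -B forces -v_s ≤ L_s κ + 2B ≤ L_t κ + 2B.
  · intro s hs
    have h1 := abs_le.1 (hy s (hs.trans ht))
    have h2 := hneg s (hs.trans ht)
    have h3 : L s * κ ≤ L t * κ := mul_le_mul_of_nonpos_right (hmono hs) hκ
    have h4 : 0 ≤ L t * κ := mul_nonneg_of_nonpos_of_nonpos (hL0 ▸ hmono (Nat.zero_le t)) hκ
    exact max_le (by linarith) (by linarith)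
  -- L moves only when y < 0, so its value at t dates from a time s with y_s ≤ 0, where L_s κ ≤ y_s
  -- - v_s + B ≤ -v_s + B, or from time 0.
  · induction t with
    | zero => exact ⟨0, le_rfl, by rw [hL0]; linarith [le_max_right (-v 0) 0]⟩
    | succ t ih =>
      rcases le_total 0 (y (t + 1)) with h | h
      · obtain ⟨s, hs, h1⟩ := ih (by omega)
        exact ⟨s, by omega, by rw [hL, min_eq_right h, add_zero]; exact h1⟩
      · refine ⟨t + 1, le_rfl, ?_⟩
        have h1 := abs_le.1 (hy (t + 1) ht)
        linarith [le_max_left (-v (t + 1)) 0]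

namespace CKSVAR

variable {d l : ℕ} {M : CKSVAR d l} {r q : ℕ} {α β : Matrix (Fin (d + 1)) (Fin r) ℝ}
  {αp βp : Matrix (Fin (d + 1)) (Fin q) ℝ}

theorem ShortMemoryBound.norm_sub_le {z : ℤ → Fin (d + 1) → ℝ} {n : ℕ} {B : ℝ}
    (h : ShortMemoryBound l β z n B) (t : ℕ) (ht : t ≤ n) (j : ℕ) (hj : j ≤ l + 1) :
    ‖z t - z (t - j)‖ ≤ j * B := by
  induction j with
  | zero => simp
  | succ j ih =>
    have h1 := ih (by omega)
    have h2 := h.diff (t - j) (by omega) (by omega)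
    have h3 : z t - z (t - (j + 1 : ℕ)) = (z t - z (t - j)) + (z (t - j) - z (t - j - 1)) := by
      have : (t : ℤ) - (j + 1 : ℕ) = t - j - 1 := by push_cast; ring
      rw [this]
      abel
    rw [h3]
    refine (norm_add_le _ _).trans ?_
    push_cast
    linarith

/-- The part of z_t outside the range of the trend is controlled by βᵀz_t, and the remainder in
`IsPath.proj_mulVec_eq` has a number of terms independent of t, all short-memory. -/
theorem exists_norm_sub_trend_le (hαβ : M.PiMat .pos = α * βᵀ) (hβ : β.rank = r)
    (hαp : IsOrthocomplement α αp) (hβp : IsOrthocomplement β βp) (hκ : M.kappa αp βp 0 ≠ 0)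
    (hc : ∃ v, M.PiMat .pos *ᵥ v = M.c) :
    ∃ C : ℝ, 0 ≤ C ∧ ∀ (u : ℕ → Fin (d + 1) → ℝ) (z : ℤ → Fin (d + 1) → ℝ) (n : ℕ) (B : ℝ),
      0 ≤ B → M.IsPath u z → ShortMemoryBound l β z n B → ∀ t : ℕ, t ≤ n →
      ‖z t - M.trend αp βp u (z 0) t -
        (∑ s ∈ Finset.Icc 1 t, min (z s 0) 0) • M.kappa αp βp‖ ≤ C * B := by
  obtain ⟨C₁, hC₁, h₁⟩ := exists_norm_sub_proj_le (αp := αp) hκ hβ hβp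
  choose C₂ hC₂ h₂ using fun m : ℕ =>
    exists_norm_mulVec_le (M.proj αp βp * M.Gamma .pos (m + 1))
  refine ⟨C₁ + (∑ m ∈ Finset.range (l + 1), C₂ m * (2 * (l + 1)) +
    ∑ i ∈ Finset.Icc 1 (l + 2), 2 * (l + 2) * ‖M.proj αp βp *ᵥ M.phiDiff i‖), ?_, ?_⟩
  · have := Finset.sum_nonneg (s := Finset.range (l + 1)) (f := fun m => C₂ m * (2 * (l + 1)))
      fun m _ => mul_nonneg (hC₂ m) (by positivity)
    positivity
  intro u z n B hB hz hb t ht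
  have h := hz.proj_mulVec_eq (βp := βp) hαβ hαp hc t
  set R := ∑ m ∈ Finset.range (l + 1), M.proj αp βp *ᵥ M.Gamma .pos (m + 1) *ᵥ
          ((z 0 - z (0 - m - 1)) - (z t - z (t - m - 1))) +
        ∑ i ∈ Finset.Icc 1 (l + 2), (∑ j ∈ Finset.range i,
          (min (z (0 - j) 0) 0 - min (z (t - j) 0) 0)) • M.proj αp βp *ᵥ M.phiDiff i with hR
  have h3 : z t - M.trend αp βp u (z 0) t -
        (∑ s ∈ Finset.Icc 1 t, min (z s 0) 0) • M.kappa αp βp =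
      (z t - M.proj αp βp *ᵥ M.GammaOne .pos *ᵥ z t) + R := by
    rw [h]; abel
  have hR' : ‖R‖ ≤ (∑ m ∈ Finset.range (l + 1), C₂ m * (2 * (l + 1)) +
      ∑ i ∈ Finset.Icc 1 (l + 2), 2 * (l + 2) * ‖M.proj αp βp *ᵥ M.phiDiff i‖) * B := by
    rw [hR, add_mul, Finset.sum_mul, Finset.sum_mul]
    refine (norm_add_le _ _).trans (add_le_add ?_ ?_)
    · refine norm_sum_le_of_le _ fun m hm => ?_
      have hm' := Finset.mem_range.1 hm
      rw [Matrix.mulVec_mulVec]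
      refine (h₂ m _).trans ?_
      rw [mul_assoc]
      refine mul_le_mul_of_nonneg_left ?_ (hC₂ m)
      have h5 := hb.norm_sub_le 0 (by omega) (m + 1) (by omega)
      have h6 := hb.norm_sub_le t ht (m + 1) (by omega)
      push_cast at h5 h6
      rw [← sub_sub] at h5 h6
      refine (norm_sub_le _ _).trans ?_
      have h7 : ((m : ℝ) + 1) * B ≤ (l + 1) * B := by
        gcongr
        exact_mod_cast (by omega : m ≤ l)
      linarith
    · refine norm_sum_le_of_le _ fun i hi => ?_
      have hi' := Finset.mem_Icc.1 hi
      rw [norm_smul, mul_right_comm]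
      refine mul_le_mul_of_nonneg_right ?_ (norm_nonneg _)
      calc ‖∑ j ∈ Finset.range i, (min (z (0 - j) 0) 0 - min (z (t - j) 0) 0)‖
          ≤ ∑ j ∈ Finset.range i, 2 * B := by
            refine norm_sum_le_of_le _ fun j hj => ?_
            have hj' := Finset.mem_range.1 hj
            have h5 := hb.neg (0 - j) (by omega) (by omega)
            have h6 := hb.neg (t - j) (by omega) (by omega)
            refine (norm_sub_le _ _).trans ?_
            rw [Real.norm_eq_abs, Real.norm_eq_abs]
            linarith
        _ = i * (2 * B) := by simp
        _ ≤ ((l + 2 : ℕ) : ℝ) * (2 * B) := by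
          gcongr
          exact hi'.2
        _ = 2 * (l + 2) * B := by push_cast; ring
  rw [h3, add_mul]
  refine (norm_add_le _ _).trans (add_le_add ((h₁ _).trans ?_) hR')
  gcongr
  exact hb.eqErr t ht

/-- The pathwise approximation of the process by the regulated trend. -/
theorem exists_pathwise_bound (hαβ : M.PiMat .pos = α * βᵀ) (hβ : β.rank = r)
    (hjsr : jointSpectralRadius {M.F α β 0, M.F α β 1} < 1)
    (hαp : IsOrthocomplement α αp) (hβp : IsOrthocomplement β βp) (hκ : M.kappa αp βp 0 < 0)
    (hc : ∃ v, M.PiMat .pos *ᵥ v = M.c) :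
    ∃ C : ℝ, 0 ≤ C ∧ ∀ (u : ℕ → Fin (d + 1) → ℝ) (z : ℤ → Fin (d + 1) → ℝ) (n : ℕ) (B : ℝ),
      M.IsPath u z → InputBound l β u z n B → ShortMemoryBound l β z n (C * B) ∧
      ∀ t : ℕ, t ≤ n → ∃ ℓ : ℝ,
        ‖z t - M.trend αp βp u (z 0) t - ((M.kappa αp βp 0)⁻¹ * ℓ) • M.kappa αp βp‖ ≤ C * B ∧
        (∀ s ≤ t, max (-M.trend αp βp u (z 0) s 0) 0 ≤ ℓ + C * B) ∧
        ∃ s ≤ t, ℓ ≤ max (-M.trend αp βp u (z 0) s 0) 0 + C * B := by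
  obtain ⟨C₁, hC₁, h₁⟩ := exists_shortMemoryBound hαβ hjsr
  obtain ⟨C₂, hC₂, h₂⟩ := exists_norm_sub_trend_le hαβ hβ hαp hβp hκ.ne hc
  -- Twice the total error, because `discrete_skorokhod` loses 2B on one side.
  refine ⟨2 * (C₁ + C₂ * C₁), by positivity, fun u z n B hz hB => ?_⟩
  have hB0 : 0 ≤ B := zero_le_one.trans hB.one_le
  have hs := h₁ u z n B hz hB
  have ht := h₂ u z n (C₁ * B) (by positivity) hz hs
  have hp1 : 0 ≤ C₁ * B := by positivity
  have hp2 : 0 ≤ C₂ * (C₁ * B) := by positivity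
  have hle1 : C₁ * B ≤ 2 * (C₁ + C₂ * C₁) * B := by nlinarith
  have hle2 : C₂ * (C₁ * B) ≤ 2 * (C₁ + C₂ * C₁) * B := by nlinarith
  refine ⟨⟨fun t h => (hs.eqErr t h).trans hle1, fun t h h' => (hs.diff t h h').trans hle1,
    fun t h h' => (hs.neg t h h').trans hle1⟩, fun t htn => ?_⟩
  let L : ℕ → ℝ := fun t => ∑ s ∈ Finset.Icc 1 t, min (z s 0) 0
  have hsk := discrete_skorokhod (y := fun t => z t 0) (v := fun t => M.trend αp βp u (z 0) t 0)
    (L := L) (κ := M.kappa αp βp 0) (B := C₁ * B + C₂ * (C₁ * B)) (n := n) hκ.le (by positivity)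
    (fun t h => by
      have h1 := (norm_le_pi_norm _ 0).trans (ht t h)
      simp only [Pi.sub_apply, Pi.smul_apply, smul_eq_mul, Real.norm_eq_abs] at h1
      exact h1.trans (by linarith))
    (fun t h => by
      have h1 := abs_le.1 (hs.neg t (by omega) (by exact_mod_cast h))
      have h2 := min_le_left (z t 0) 0
      linarith) (by simp [L])
    (fun t => by
      simp only [L]
      rw [Finset.sum_Icc_succ_top (by omega)])
    t htn
  obtain ⟨ha, s, hst, hb⟩ := hsk
  -- With ℓ = κ₁L_t, the vector κ₁⁻¹ℓκ is L_tκ.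
  refine ⟨L t * M.kappa αp βp 0, ?_, fun s h => (ha s h).trans ?_, s, hst, hb.trans ?_⟩
  · have : (M.kappa αp βp 0)⁻¹ * (L t * M.kappa αp βp 0) = L t := by
      field_simp [hκ.ne]
    rw [this]
    exact (ht t htn).trans hle2
  · linarith
  · linarith

end CKSVAR

/-! ### Cadlag functions -/

theorem IsCadlag.comp {E F : Type*} [TopologicalSpace E] [TopologicalSpace F] {f : I → E}
    (hf : IsCadlag f) {g : E → F} (hg : Continuous g) : IsCadlag (fun t => g (f t)) := by
  intro t
  obtain ⟨h1, l, h2⟩ := hf t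
  exact ⟨hg.continuousAt.comp_continuousWithinAt h1, g l, (hg.tendsto l).comp h2⟩

theorem IsCadlag.prodMk {E F : Type*} [TopologicalSpace E] [TopologicalSpace F] {f : I → E}
    {g : I → F} (hf : IsCadlag f) (hg : IsCadlag g) : IsCadlag (fun t => (f t, g t)) := by
  intro t
  obtain ⟨h1, l, h2⟩ := hf t
  obtain ⟨h3, m, h4⟩ := hg t
  exact ⟨h1.prodMk h3, (l, m), h2.prodMk_nhds h4⟩

/-- Near each point, right-continuity and the left limit bound f on the two sides; compactness makes
the bound uniform. The suprema in the regulator are thereby genuine. -/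
theorem IsCadlag.exists_abs_le {f : I → ℝ} (hf : IsCadlag f) : ∃ C : ℝ, ∀ t, |f t| ≤ C := by
  have key : ∃ C : ℝ, ∀ t ∈ (Set.univ : Set I), |f t| ≤ C := by
    refine isCompact_univ.induction_on (p := fun s => ∃ C : ℝ, ∀ t ∈ s, |f t| ≤ C) ⟨0, by simp⟩
      ?_ ?_ ?_
    · rintro s t hst ⟨C, hC⟩
      exact ⟨C, fun x hx => hC x (hst hx)⟩
    · rintro s t ⟨C, hC⟩ ⟨D, hD⟩
      refine ⟨max C D, fun x hx => ?_⟩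
      rcases hx with hx | hx
      · exact (hC x hx).trans (le_max_left _ _)
      · exact (hD x hx).trans (le_max_right _ _)
    · intro t _
      obtain ⟨h1, l, h2⟩ := hf t
      have h3 : ∀ᶠ s in 𝓝[≥] t, |f s| ≤ |f t| + 1 :=
        (h1.abs.eventually_lt_const (lt_add_one _)).mono fun s hs => hs.le
      have h4 : ∀ᶠ s in 𝓝[<] t, |f s| ≤ |l| + 1 :=
        (h2.abs.eventually_lt_const (lt_add_one _)).mono fun s hs => hs.le
      have h5 : ∀ᶠ s in 𝓝 t, |f s| ≤ max (|f t| + 1) (|l| + 1) := by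
        rw [← nhdsLT_sup_nhdsGE, eventually_sup]
        exact ⟨h4.mono fun s hs => hs.trans (le_max_right _ _),
          h3.mono fun s hs => hs.trans (le_max_left _ _)⟩
      rw [nhdsWithin_univ]
      exact ⟨_, h5, _, fun s hs => hs⟩
  obtain ⟨C, hC⟩ := key
  exact ⟨C, fun t => hC t trivial⟩

/-! ### The regulator -/

theorem bddAbove_regulator {w : I → ℝ} {C : ℝ} (hw : ∀ t, |w t| ≤ C) (t : I) :
    BddAbove (Set.range fun s : Set.Iic t => max (-w s) 0) := by
  refine ⟨C, ?_⟩
  rintro _ ⟨s, rfl⟩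
  exact max_le (by linarith [abs_le.1 (hw s)]) ((abs_nonneg _).trans (hw s))

theorem le_regulator {w : I → ℝ} {C : ℝ} (hw : ∀ t, |w t| ≤ C) {s t : I} (hst : s ≤ t) :
    max (-w s) 0 ≤ regulator w t :=
  le_ciSup (bddAbove_regulator hw t) (⟨s, hst⟩ : Set.Iic t)

theorem regulator_le {w : I → ℝ} {t : I} {a : ℝ} (h : ∀ s ≤ t, max (-w s) 0 ≤ a) :
    regulator w t ≤ a :=
  haveI : Nonempty (Set.Iic t) := ⟨⟨t, le_refl t⟩⟩
  ciSup_le fun s => h s s.2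

theorem regulator_mono {w : I → ℝ} {C : ℝ} (hw : ∀ t, |w t| ≤ C) : Monotone (regulator w) :=
  fun _ _ hst => regulator_le fun _ hs => le_regulator hw (hs.trans hst)

theorem regulator_le_add {w w' : I → ℝ} {C ε : ℝ} (hw' : ∀ t, |w' t| ≤ C)
    (h : ∀ t, |w t - w' t| ≤ ε) (t : I) : regulator w t ≤ regulator w' t + ε := by
  refine regulator_le fun s hs => ?_
  have h1 := le_regulator hw' hs
  have h2 := abs_le.1 (h s)
  have h3 := le_max_left (-w' s) 0
  have h4 := le_max_right (-w' s) 0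
  exact max_le (by linarith) (by linarith [(abs_nonneg _).trans (h s)])

theorem abs_regulator_sub_le {w w' : I → ℝ} {C C' ε : ℝ} (hw : ∀ t, |w t| ≤ C)
    (hw' : ∀ t, |w' t| ≤ C') (h : ∀ t, |w t - w' t| ≤ ε) (t : I) :
    |regulator w t - regulator w' t| ≤ ε := by
  have h1 := regulator_le_add hw' h t
  have h2 := regulator_le_add hw (fun t => by rw [abs_sub_comm]; exact h t) t
  exact abs_le.2 ⟨by linarith, by linarith⟩

/-- Left limits come from monotonicity. For right-continuity, the regulator grows just after t by no
more than w falls below w t there. -/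
theorem IsCadlag.regulator {w : I → ℝ} (hw : IsCadlag w) : IsCadlag (regulator w) := by
  obtain ⟨C, hC⟩ := hw.exists_abs_le
  have hmono := regulator_mono hC
  intro t
  refine ⟨?_, _, hmono.tendsto_nhdsLT t⟩
  rw [Metric.continuousWithinAt_iff']
  intro ε hε
  have h1 := (Metric.continuousWithinAt_iff'.1 (hw t).1) (ε / 2) (by positivity)
  rw [eventually_nhdsWithin_iff, Filter.Eventually, Metric.mem_nhds_iff] at h1
  obtain ⟨η, hη, hball⟩ := h1
  rw [eventually_nhdsWithin_iff, Filter.Eventually, Metric.mem_nhds_iff]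
  refine ⟨η, hη, fun s hs hts => ?_⟩
  have hts' : t ≤ s := hts
  rw [Real.dist_eq, abs_of_nonneg (sub_nonneg.2 (hmono hts'))]
  have h2 : RegCoint.regulator w s ≤ RegCoint.regulator w t + ε / 2 := by
    refine regulator_le fun x hx => ?_
    rcases le_total x t with hxt | hxt
    · linarith [le_regulator hC hxt]
    · have hx' : x ∈ Metric.ball t η := by
        rw [Metric.mem_ball, Subtype.dist_eq, Real.dist_eq, abs_of_nonneg] at hs ⊢
        · have : (x : ℝ) ≤ s := hx
          linarith
        · have : (t : ℝ) ≤ x := hxt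
          linarith
        · have : (t : ℝ) ≤ s := hts'
          linarith
      have h3 := hball hx' hxt
      rw [Real.dist_eq] at h3
      have h4 := abs_lt.1 h3
      have h5 := le_regulator hC (le_refl t)
      have h6 := le_max_left (-w t) 0
      have h7 := le_max_right (-w t) 0
      exact max_le (by linarith) (by linarith)
  linarith

/-! ### Maps into the space of cadlag functions -/

namespace CadlagSpace

variable {E : Type*} [EMetricSpace E]

/-- A cadlag function as an element of `CadlagSpace`. -/
def mk (f : I → E) (hf : IsCadlag f) : CadlagSpace E := ⟨UniformFun.ofFun f, hf⟩

theorem isCadlag_path (f : CadlagSpace E) : IsCadlag f.path := f.2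

theorem edist_path_le (f g : CadlagSpace E) (t : I) :
    edist (f.path t) (g.path t) ≤ edist f g :=
  le_iSup (fun t => edist (f.path t) (g.path t)) t

theorem edist_le_iff {f g : CadlagSpace E} {a : ℝ≥0∞} :
    edist f g ≤ a ↔ ∀ t, edist (f.path t) (g.path t) ≤ a := iSup_le_iff

end CadlagSpace

/-- Just to the right of t the floor keeps its value; just to the left it equals ⌈nt⌉ - 1, which
identifies the left limit. -/
theorem isCadlag_step {E : Type*} [TopologicalSpace E] (x : ℕ → E) (n : ℕ) :
    IsCadlag (fun t : I => x ⌊n * (t : ℝ)⌋₊) := by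
  rcases Nat.eq_zero_or_pos n with rfl | hn
  · intro t
    simp only [Nat.cast_zero, zero_mul, Nat.floor_zero]
    exact ⟨continuousWithinAt_const, x 0, tendsto_const_nhds⟩
  have hn' : (0 : ℝ) < n := by exact_mod_cast hn
  have hcont : Continuous fun s : I => (n : ℝ) * (s : ℝ) := by fun_prop
  intro t
  have ht0 : 0 ≤ (n : ℝ) * t := mul_nonneg hn'.le t.2.1
  constructor
  · suffices h : (fun s : I => x ⌊n * (s : ℝ)⌋₊) =ᶠ[𝓝[≥] t] fun _ => x ⌊n * (t : ℝ)⌋₊ from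
      (continuousWithinAt_const (b := x ⌊n * (t : ℝ)⌋₊)).congr_of_eventuallyEq h rfl
    have h1 : ∀ᶠ s : I in 𝓝 t, (n : ℝ) * s < ⌊n * (t : ℝ)⌋₊ + 1 :=
      hcont.continuousAt.eventually_lt_const (Nat.lt_floor_add_one _)
    filter_upwards [nhdsWithin_le_nhds h1, self_mem_nhdsWithin] with s hs hts
    have hts' : (t : ℝ) ≤ s := hts
    congr 1
    have h2 : (n : ℝ) * t ≤ n * s := by gcongr
    rw [Nat.floor_eq_iff (ht0.trans h2)]
    exact ⟨(Nat.floor_le ht0).trans h2, hs⟩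
  · refine ⟨x (⌈n * (t : ℝ)⌉₊ - 1), ?_⟩
    apply Tendsto.congr' _ tendsto_const_nhds
    have h1 : ∀ᶠ s : I in 𝓝 t, (⌈n * (t : ℝ)⌉₊ : ℝ) - 1 < n * s := by
      refine hcont.continuousAt.eventually_const_lt ?_
      have := Nat.ceil_lt_add_one ht0
      linarith
    filter_upwards [nhdsWithin_le_nhds h1, self_mem_nhdsWithin] with s hs hts
    have hts' : (s : ℝ) < t := hts
    have hs0 : (0 : ℝ) ≤ s := s.2.1
    congr 1
    have h2 : (n : ℝ) * s < n * t := by gcongr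
    have h3 : (0 : ℝ) ≤ n * s := by positivity
    have h4 : 0 < ⌈n * (t : ℝ)⌉₊ := Nat.ceil_pos.2 (h3.trans_lt h2)
    symm
    rw [Nat.floor_eq_iff h3]
    rw [Nat.cast_sub h4, Nat.cast_one]
    exact ⟨hs.le, by linarith [Nat.le_ceil ((n : ℝ) * t)]⟩

theorem floor_mul_le (n : ℕ) (t : I) : ⌊n * (t : ℝ)⌋₊ ≤ n := by
  refine (Nat.floor_le_floor (mul_le_of_le_one_right (Nat.cast_nonneg n) t.2.2)).trans ?_
  rw [Nat.floor_natCast]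

/-- The step function with given values on the grid of mesh `1 / n`. -/
def stepFun {E : Type*} [EMetricSpace E] (n : ℕ) (x : Fin (n + 1) → E) : CadlagSpace E :=
  CadlagSpace.mk (fun t : I => x ⟨⌊n * (t : ℝ)⌋₊, Nat.lt_succ_of_le (floor_mul_le n t)⟩) (by
    have h := isCadlag_step (fun m => if h : m < n + 1 then x ⟨m, h⟩ else x 0) n
    have h1 : ∀ t : I, ⌊n * (t : ℝ)⌋₊ < n + 1 := fun t => Nat.lt_succ_of_le (floor_mul_le n t)
    simpa only [h1, dif_pos] using h)

/-- Provides measurability into a nonseparable space: a random step function is a continuous image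
of finitely many random vectors. -/
theorem continuous_stepFun {E : Type*} [EMetricSpace E] (n : ℕ) :
    Continuous (stepFun (E := E) n) := by
  apply LipschitzWith.continuous (K := 1)
  intro x y
  rw [ENNReal.coe_one, one_mul, CadlagSpace.edist_le_iff]
  intro t
  exact edist_le_pi_edist x y _

section Probability

variable {Ω : Type*} [MeasurableSpace Ω] {P : Measure Ω}

/-! ### Negligible sequences -/

/-- The positive part of `f n` tends to zero in probability. -/
def Vanishes (P : Measure Ω) (f : ℕ → Ω → ℝ) : Prop :=
  ∀ ε : ℝ, 0 < ε → Tendsto (fun n => P {ω | ε ≤ f n ω}) atTop (𝓝 0)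

theorem Vanishes.mono {f g : ℕ → Ω → ℝ} (hf : Vanishes P f) (h : ∀ n ω, g n ω ≤ f n ω) :
    Vanishes P g := fun ε hε =>
  tendsto_of_tendsto_of_tendsto_of_le_of_le tendsto_const_nhds (hf ε hε) (fun _ => zero_le)
    fun n => measure_mono fun ω hω => le_trans hω (h n ω)

theorem Vanishes.add {f g : ℕ → Ω → ℝ} (hf : Vanishes P f) (hg : Vanishes P g) :
    Vanishes P (fun n ω => f n ω + g n ω) := by
  intro ε hε
  have h := (hf (ε / 2) (by positivity)).add (hg (ε / 2) (by positivity))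
  rw [add_zero] at h
  refine tendsto_of_tendsto_of_tendsto_of_le_of_le tendsto_const_nhds h (fun _ => zero_le)
    fun n => (measure_mono fun ω hω => ?_).trans (measure_union_le _ _)
  by_contra hcon
  simp only [Set.mem_union, Set.mem_ofPred_eq, not_or, not_le] at hcon hω
  linarith

theorem Vanishes.const_mul {f : ℕ → Ω → ℝ} (hf : Vanishes P f) {C : ℝ} (hC : 0 ≤ C) :
    Vanishes P (fun n ω => C * f n ω) := by
  intro ε hε
  refine tendsto_of_tendsto_of_tendsto_of_le_of_le tendsto_const_nhds
    (hf (ε / (C + 1)) (by positivity)) (fun _ => zero_le) fun n => measure_mono fun ω hω => ?_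
  simp only [Set.mem_ofPred_eq] at hω ⊢
  rw [div_le_iff₀ (by positivity)]
  have : 0 < f n ω := by
    by_contra h
    nlinarith
  nlinarith

theorem vanishes_of_tendsto {c : ℕ → ℝ} (hc : Tendsto c atTop (𝓝 0)) :
    Vanishes P (fun n _ => c n) := by
  intro ε hε
  apply tendsto_const_nhds.congr'
  filter_upwards [hc.eventually_lt_const hε] with n hn
  simp [not_le.2 hn]

theorem Vanishes.tendstoInMeasure {f : ℕ → Ω → ℝ} (hf : Vanishes P f)
    (h0 : ∀ n ω, 0 ≤ f n ω) : TendstoInMeasure P f atTop (fun _ => (0 : ℝ)) := by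
  rw [tendstoInMeasure_iff_norm]
  intro ε hε
  simpa only [sub_zero, Real.norm_eq_abs, abs_of_nonneg (h0 _ _)] using hf ε hε

theorem vanishes_norm_sub {E : Type*} [SeminormedAddCommGroup E] {f : ℕ → Ω → E} {g : Ω → E}
    (h : TendstoInMeasure P f atTop g) : Vanishes P (fun n ω => ‖f n ω - g ω‖) :=
  tendstoInMeasure_iff_norm.1 h

/-- Maxima of `O(n)` random vectors with uniformly bounded moments of order greater than `2` are
`o_p(√n)`. -/
theorem BoundedMoments.vanishes_sup {ι E : Type*} [NormedAddCommGroup E] {f : ι → Ω → E}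
    {s : Set ι} {δ : ℝ} (hδ : 0 < δ) (h : BoundedMoments f s (2 + δ) P) (T : ℕ → Finset ι)
    (hT : ∀ n, ∀ i ∈ T n, i ∈ s) (K : ℕ) (hcard : ∀ n, (T n).card ≤ K + n) :
    Vanishes P (fun n ω => (√(n : ℝ))⁻¹ * (((T n).sup fun i => ‖f i ω‖₊ : ℝ≥0) : ℝ)) := by
  obtain ⟨hmeas, C, hC⟩ := h
  intro ε hε
  let p : ℝ := 2 + δ
  have hp : 0 < p := by simp only [p]; linarith
  -- A union bound over at most K + n indices and Markov's inequality of order p = 2 + δ give, up to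
  -- constants, n · n^(-p/2) = n^(-δ/2).
  have hlim : Tendsto (fun n : ℕ => ENNReal.ofReal
      ((K + 1) * (ε⁻¹ * C) ^ p * (n : ℝ) ^ (-(δ / 2)))) atTop (𝓝 0) := by
    rw [← ENNReal.ofReal_zero]
    refine ENNReal.tendsto_ofReal ?_
    have h1 := (tendsto_rpow_neg_atTop (y := δ / 2) (by positivity)).comp
      tendsto_natCast_atTop_atTop
    simpa using h1.const_mul ((K + 1) * (ε⁻¹ * C) ^ p)
  refine tendsto_of_tendsto_of_tendsto_of_le_of_le' tendsto_const_nhds hlim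
    (Eventually.of_forall fun _ => zero_le) ?_
  filter_upwards [eventually_ge_atTop 1] with n hn
  have hn0 : (0 : ℝ) < n := by exact_mod_cast hn
  have hs0 : 0 < √(n : ℝ) := Real.sqrt_pos.2 hn0
  have hsub : {ω | ε ≤ (√(n : ℝ))⁻¹ * (((T n).sup fun i => ‖f i ω‖₊ : ℝ≥0) : ℝ)} ⊆
      ⋃ i ∈ T n, {ω | ENNReal.ofReal (ε * √(n : ℝ)) ≤ ‖f i ω‖ₑ} := by
    intro ω hω
    by_contra hcon
    simp only [Set.mem_iUnion, Set.mem_ofPred_eq, not_exists, not_le] at hcon hω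
    have h1 : ((T n).sup fun i => ‖f i ω‖₊) < (ε * √(n : ℝ)).toNNReal := by
      rw [Finset.sup_lt_iff (by simpa using by positivity)]
      intro i hi
      have := hcon i hi
      rw [ENNReal.ofReal, enorm_eq_nnnorm, ENNReal.coe_lt_coe] at this
      exact this
    have h2 : (((T n).sup fun i => ‖f i ω‖₊ : ℝ≥0) : ℝ) < ε * √(n : ℝ) := by
      rwa [Real.lt_toNNReal_iff_coe_lt] at h1
    rw [inv_mul_eq_div, le_div_iff₀ hs0] at hω
    linarith
  have hm : ∀ i ∈ T n, P {ω | ENNReal.ofReal (ε * √(n : ℝ)) ≤ ‖f i ω‖ₑ} ≤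
      ENNReal.ofReal ((ε⁻¹ * C * (√(n : ℝ))⁻¹) ^ p) := by
    intro i hi
    have hpos : 0 < ε * √(n : ℝ) := by positivity
    have h1 := meas_ge_le_mul_pow_eLpNorm_enorm P (p := ENNReal.ofReal p) (by simpa using hp)
      ENNReal.ofReal_ne_top (hmeas i (hT n i hi)) (ε := ENNReal.ofReal (ε * √(n : ℝ)))
      (by simpa using hpos) (by simp)
    refine h1.trans ?_
    rw [ENNReal.toReal_ofReal hp.le, ← ENNReal.mul_rpow_of_nonneg _ _ hp.le,
      ← ENNReal.ofReal_rpow_of_nonneg (by positivity) hp.le]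
    gcongr
    rw [← ENNReal.ofReal_inv_of_pos hpos]
    calc ENNReal.ofReal (ε * √(n : ℝ))⁻¹ * eLpNorm (f i) (ENNReal.ofReal p) P
        ≤ ENNReal.ofReal (ε * √(n : ℝ))⁻¹ * C := by
          gcongr
          exact hC i (hT n i hi)
      _ = ENNReal.ofReal (ε⁻¹ * C * (√(n : ℝ))⁻¹) := by
        rw [← ENNReal.ofReal_coe_nnreal, ← ENNReal.ofReal_mul (by positivity), mul_inv]
        congr 1
        ring
  calc P {ω | ε ≤ (√(n : ℝ))⁻¹ * (((T n).sup fun i => ‖f i ω‖₊ : ℝ≥0) : ℝ)}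
      ≤ ∑ i ∈ T n, P {ω | ENNReal.ofReal (ε * √(n : ℝ)) ≤ ‖f i ω‖ₑ} :=
        (measure_mono hsub).trans (measure_biUnion_finset_le _ _)
    _ ≤ ∑ i ∈ T n, ENNReal.ofReal ((ε⁻¹ * C * (√(n : ℝ))⁻¹) ^ p) := Finset.sum_le_sum hm
    _ = ENNReal.ofReal ((T n).card * (ε⁻¹ * C * (√(n : ℝ))⁻¹) ^ p) := by
      rw [Finset.sum_const, nsmul_eq_mul, ENNReal.ofReal_mul (by positivity),
        ENNReal.ofReal_natCast]
    _ ≤ _ := by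
      apply ENNReal.ofReal_le_ofReal
      rw [Real.mul_rpow (by positivity) (by positivity)]
      have h2 : ((√(n : ℝ))⁻¹) ^ p = (n : ℝ)⁻¹ * (n : ℝ) ^ (-(δ / 2)) := by
        rw [Real.sqrt_eq_rpow, ← Real.rpow_neg hn0.le, ← Real.rpow_mul hn0.le,
          ← Real.rpow_neg_one (n : ℝ), ← Real.rpow_add hn0]
        congr 1
        simp only [p]
        ring
      rw [h2]
      have h3 : ((T n).card : ℝ) * (n : ℝ)⁻¹ ≤ K + 1 := by
        rw [← div_eq_mul_inv, div_le_iff₀ hn0]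
        have h4 : ((T n).card : ℝ) ≤ K + n := by exact_mod_cast hcard n
        have h5 : (1 : ℝ) ≤ n := by exact_mod_cast hn
        nlinarith [(Nat.cast_nonneg K : (0 : ℝ) ≤ K)]
      calc ((T n).card : ℝ) * ((ε⁻¹ * C) ^ p * ((n : ℝ)⁻¹ * (n : ℝ) ^ (-(δ / 2))))
          = ((T n).card : ℝ) * (n : ℝ)⁻¹ * ((ε⁻¹ * C) ^ p * (n : ℝ) ^ (-(δ / 2))) := by ring
        _ ≤ (K + 1) * ((ε⁻¹ * C) ^ p * (n : ℝ) ^ (-(δ / 2))) := by gcongr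
        _ = _ := by ring

/-! ### Asymptotically equivalent sequences of random elements -/

/-- Random elements whose distance tends to zero in probability have the same limit in
distribution; no separability is assumed. -/
theorem tendstoInDistribution_of_vanishes {Ω' : Type*} [MeasurableSpace Ω'] {P' : Measure Ω'}
    [IsProbabilityMeasure P] [IsProbabilityMeasure P'] {E : Type*} [EMetricSpace E]
    [MeasurableSpace E] [BorelSpace E] {X Y : ℕ → Ω → E} {Z : Ω' → E}
    (hX : TendstoInDistribution X atTop Z (fun _ => P) P') (hY : ∀ n, AEMeasurable (Y n) P)
    {D : ℕ → Ω → ℝ} (hD : Vanishes P D)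
    (hXY : ∀ᶠ n in atTop, ∀ᵐ ω ∂P, edist (Y n ω) (X n ω) ≤ ENNReal.ofReal (D n ω)) :
    TendstoInDistribution Y atTop Z (fun _ => P) P' := by
  have hXm := hX.forall_aemeasurable
  refine ⟨hY, hX.aemeasurable_limit, ?_⟩
  have hXt := tendsto_iff_forall_lipschitz_integral_tendsto.1 hX.tendsto
  refine tendsto_iff_forall_lipschitz_integral_tendsto.2 ?_
  rintro F ⟨C, hC⟩ ⟨K, hK⟩
  have h1 := hXt F ⟨C, hC⟩ ⟨K, hK⟩
  simp only [ProbabilityMeasure.coe_mk] at h1 ⊢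
  have hFc : Continuous F := hK.continuous
  have hC0 : 0 ≤ C := by
    obtain ⟨ω⟩ := nonempty_of_isProbabilityMeasure P
    exact dist_nonneg.trans (hC (X 0 ω) (X 0 ω))
  have hF_int : ∀ W : Ω → E, AEMeasurable W P → Integrable (fun ω => F (W ω)) P := by
    intro W hW
    obtain ⟨ω₀⟩ := nonempty_of_isProbabilityMeasure P
    refine Integrable.of_bound (hFc.measurable.comp_aemeasurable hW).aestronglyMeasurable
      (‖F (W ω₀)‖ + C) (ae_of_all _ fun ω => ?_)
    have h2 := hC (W ω) (W ω₀)
    rw [dist_eq_norm] at h2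
    linarith [norm_sub_norm_le (F (W ω)) (F (W ω₀))]
  have hmap : ∀ W : Ω → E, AEMeasurable W P → ∫ x, F x ∂(P.map W) = ∫ ω, F (W ω) ∂P :=
    fun W hW => integral_map hW hFc.measurable.aestronglyMeasurable
  suffices hdiff : Tendsto (fun n => ∫ ω, F (Y n ω) ∂P - ∫ ω, F (X n ω) ∂P) atTop (𝓝 0) by
    have h2 := h1.add hdiff
    simp only [add_zero] at h2
    refine h2.congr fun n => ?_
    rw [hmap _ (hXm n), hmap _ (hY n)]
    ring
  rw [Metric.tendsto_nhds]
  intro ε hε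
  let η : ℝ := ε / (2 * (K + 1))
  have hη : 0 < η := by positivity
  -- `D n` need not be measurable, hence the measurable hull.
  let A : ℕ → Set Ω := fun n => toMeasurable P {ω | η ≤ D n ω}
  have hA : Tendsto (fun n => C * P.real (A n)) atTop (𝓝 0) := by
    have h3 := hD η hη
    have h4 : Tendsto (fun n => (P (A n)).toReal) atTop (𝓝 0) := by
      rw [← ENNReal.toReal_zero]
      refine (ENNReal.tendsto_toReal ENNReal.zero_ne_top).comp ?_
      simpa only [A, measure_toMeasurable] using h3
    simpa [measureReal_def] using h4.const_mul C
  filter_upwards [hA.eventually_lt_const (half_pos hε), hXY] with n hn hXYn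
  rw [dist_zero_right, ← integral_sub (hF_int _ (hY n)) (hF_int _ (hXm n))]
  have hAm : MeasurableSet (A n) := measurableSet_toMeasurable _ _
  -- Off `A n` the Lipschitz bound applies with distance below η; on `A n` the oscillation of F is
  -- at most C.
  have hbound : ∀ᵐ ω ∂P, ‖F (Y n ω) - F (X n ω)‖ ≤ K * η + (A n).indicator (fun _ => C) ω := by
    filter_upwards [hXYn] with ω hω
    rw [← dist_eq_norm]
    by_cases hωA : ω ∈ A n
    · rw [Set.indicator_of_mem hωA]
      exact (hC _ _).trans (le_add_of_nonneg_left (by positivity))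
    · rw [Set.indicator_of_notMem hωA, add_zero]
      have h5 : D n ω < η := by
        by_contra hcon
        exact hωA (subset_toMeasurable P _ (not_lt.1 hcon))
      have h6 : edist (F (Y n ω)) (F (X n ω)) ≤ ENNReal.ofReal (K * η) := by
        refine (hK _ _).trans ?_
        rw [ENNReal.ofReal_mul (NNReal.coe_nonneg K), ENNReal.ofReal_coe_nnreal]
        gcongr
        exact hω.trans (ENNReal.ofReal_le_ofReal h5.le)
      rw [edist_dist] at h6
      exact (ENNReal.ofReal_le_ofReal_iff (by positivity)).1 h6
  have hintb : Integrable (fun ω => K * η + (A n).indicator (fun _ => C) ω) P :=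
    (integrable_const _).add ((integrable_const C).indicator hAm)
  calc ‖∫ ω, (F (Y n ω) - F (X n ω)) ∂P‖
      ≤ ∫ ω, (K * η + (A n).indicator (fun _ => C) ω) ∂P :=
        norm_integral_le_of_norm_le hintb hbound
    _ = K * η + C * P.real (A n) := by
      rw [integral_add (integrable_const _) ((integrable_const C).indicator hAm),
        integral_indicator hAm]
      simp [mul_comm]
    _ < ε := by
      have h7 : K * η ≤ ε / 2 := by
        simp only [η]
        rw [mul_div_assoc', div_le_div_iff₀ (by positivity) (by positivity)]
        nlinarith [K.2]
      linarith

/-! ### Linear functionals of Brownian motions -/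

theorem map_dotProduct_multivariateGaussian {ι : Type*} [Fintype ι] [DecidableEq ι]
    {S : Matrix ι ι ℝ} (hS : S.PosSemidef) (a : EuclideanSpace ℝ ι) :
    (multivariateGaussian 0 S).map (innerSL ℝ a) =
      gaussianReal 0 (a.ofLp ⬝ᵥ S *ᵥ a.ofLp).toNNReal := by
  rw [IsGaussian.map_eq_gaussianReal, ContinuousLinearMap.integral_comp_id_comm
    IsGaussian.integrable_id, integral_id_multivariateGaussian, map_zero,
    ← covarianceBilin_multivariateGaussian (μ := 0) hS, covarianceBilin_self]
  · rfl
  · exact IsGaussian.memLp_two_id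

end Probability

/-! ### Matrices acting on Euclidean vectors -/

/-- `act A` as a continuous linear map. -/
def actL {m n : Type*} [Fintype m] [Fintype n] (A : Matrix m n ℝ) :
    EuclideanSpace ℝ n →L[ℝ] EuclideanSpace ℝ m :=
  LinearMap.toContinuousLinearMap
    { toFun := act A
      map_add' := fun v w => by simp [act, Matrix.mulVec_add]
      map_smul' := fun c v => by simp [act, Matrix.mulVec_smul] }

theorem actL_apply {m n : Type*} [Fintype m] [Fintype n] (A : Matrix m n ℝ)
    (v : EuclideanSpace ℝ n) : actL A v = act A v := rfl

theorem norm_ofLp_le {n : Type*} [Fintype n] (v : EuclideanSpace ℝ n) : ‖v.ofLp‖ ≤ ‖v‖ :=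
  (pi_norm_le_iff_of_nonneg (norm_nonneg _)).2 fun i => PiLp.norm_apply_le v i

theorem exists_norm_toLp_le (n : Type*) [Fintype n] :
    ∃ C : ℝ, 0 ≤ C ∧ ∀ x : n → ℝ, ‖(WithLp.toLp 2 x : EuclideanSpace ℝ n)‖ ≤ C * ‖x‖ := by
  let e := (PiLp.continuousLinearEquiv 2 ℝ (fun _ : n => ℝ)).symm
  exact ⟨‖(e : (n → ℝ) →L[ℝ] EuclideanSpace ℝ n)‖, norm_nonneg _,
    (e : (n → ℝ) →L[ℝ] EuclideanSpace ℝ n).le_opNorm⟩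

/-! ### Regulated paths -/

/-- Adding a multiple of the regulator of the first coordinate is a Lipschitz operation. -/
theorem norm_regulated_sub_le {d : ℕ} {v v' : I → EuclideanSpace ℝ (Fin (d + 1))} {C C' ε : ℝ}
    (hv : ∀ t, |v t 0| ≤ C) (hv' : ∀ t, |v' t 0| ≤ C') (h : ∀ t, ‖v t - v' t‖ ≤ ε)
    (c : ℝ) (k : EuclideanSpace ℝ (Fin (d + 1))) (t : I) :
    ‖(v t + (c * regulator (fun s => v s 0) t) • k) -
      (v' t + (c * regulator (fun s => v' s 0) t) • k)‖ ≤ (1 + |c| * ‖k‖) * ε := by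
  have h1 := abs_regulator_sub_le hv hv' (fun t => (PiLp.norm_apply_le (v t - v' t) 0).trans (h t)) t
  have h2 : (v t + (c * regulator (fun s => v s 0) t) • k) -
      (v' t + (c * regulator (fun s => v' s 0) t) • k) = (v t - v' t) +
      (c * (regulator (fun s => v s 0) t - regulator (fun s => v' s 0) t)) • k := by
    module
  rw [h2]
  refine (norm_add_le _ _).trans ?_
  rw [norm_smul, Real.norm_eq_abs, abs_mul, add_mul, one_mul, mul_assoc, mul_assoc, mul_comm ‖k‖]
  gcongr
  exact h t

namespace CKSVAR

variable {d l : ℕ} (M : CKSVAR d l) {r q : ℕ} {α β : Matrix (Fin (d + 1)) (Fin r) ℝ}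
  (αp βp : Matrix (Fin (d + 1)) (Fin q) ℝ) (Z₀ : EuclideanSpace ℝ (Fin (d + 1)))

theorem isCadlag_projU (f : CadlagSpace (EuclideanSpace ℝ (Fin (d + 1)))) :
    IsCadlag fun t => M.projU αp βp Z₀ (fun t f => CadlagSpace.path f t) t f := by
  refine f.isCadlag_path.comp (g := fun x => act (M.proj αp βp) (act (M.GammaOne .pos) Z₀ + x)) ?_
  simp only [← actL_apply]
  fun_prop

theorem isCadlag_projU_zero (f : CadlagSpace (EuclideanSpace ℝ (Fin (d + 1)))) :
    IsCadlag fun t => M.projU αp βp Z₀ (fun t f => CadlagSpace.path f t) t f 0 :=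
  (M.isCadlag_projU αp βp Z₀ f).comp (g := fun x => x 0) (by fun_prop)

theorem isCadlag_limitPath (f : CadlagSpace (EuclideanSpace ℝ (Fin (d + 1)))) :
    IsCadlag fun t => M.limitPath αp βp Z₀ (fun t f => CadlagSpace.path f t) t f := by
  refine ((M.isCadlag_projU αp βp Z₀ f).prodMk (M.isCadlag_projU_zero αp βp Z₀ f).regulator).comp
    (g := fun x => x.1 + ((M.kappa αp βp 0)⁻¹ * x.2) • WithLp.toLp 2 (M.kappa αp βp)) ?_
  fun_prop

/-- The map which sends a path of the errors to the path of the limit process. -/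
def limitMap (f : CadlagSpace (EuclideanSpace ℝ (Fin (d + 1)))) :
    CadlagSpace (EuclideanSpace ℝ (Fin (d + 1))) :=
  CadlagSpace.mk _ (M.isCadlag_limitPath αp βp Z₀ f)

theorem limitMap_path (f : CadlagSpace (EuclideanSpace ℝ (Fin (d + 1)))) (t : I) :
    (M.limitMap αp βp Z₀ f).path t =
      M.limitPath αp βp Z₀ (fun t f => CadlagSpace.path f t) t f := rfl

theorem continuous_limitMap : Continuous (M.limitMap αp βp Z₀) := by
  let K : ℝ := (1 + |(M.kappa αp βp 0)⁻¹| * ‖(WithLp.toLp 2 (M.kappa αp βp) :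
    EuclideanSpace ℝ (Fin (d + 1)))‖) * ‖actL (M.proj αp βp)‖
  have hK : 0 ≤ K := by positivity
  -- The added 1 keeps the constant nonzero, so that the bound is trivial at infinite distance.
  apply LipschitzWith.continuous (K := K.toNNReal + 1)
  intro f g
  by_cases htop : edist f g = ⊤
  · rw [htop, ENNReal.mul_top (by simp)]
    exact le_top
  have hdist : ∀ t, ‖f.path t - g.path t‖ ≤ (edist f g).toReal := by
    intro t
    have := ENNReal.toReal_mono htop (CadlagSpace.edist_path_le f g t)
    rwa [edist_dist, ENNReal.toReal_ofReal dist_nonneg, dist_eq_norm] at this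
  rw [CadlagSpace.edist_le_iff]
  intro t
  obtain ⟨C, hC⟩ := (M.isCadlag_projU_zero αp βp Z₀ f).exists_abs_le
  obtain ⟨C', hC'⟩ := (M.isCadlag_projU_zero αp βp Z₀ g).exists_abs_le
  have h := norm_regulated_sub_le hC hC' (ε := ‖actL (M.proj αp βp)‖ * (edist f g).toReal)
    (fun s => by
      have h1 : M.projU αp βp Z₀ (fun t f => CadlagSpace.path f t) s f -
          M.projU αp βp Z₀ (fun t f => CadlagSpace.path f t) s g =
          actL (M.proj αp βp) (f.path s - g.path s) := by
        simp only [projU, ← actL_apply, map_add, map_sub]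
        abel
      rw [h1]
      refine ((actL (M.proj αp βp)).le_opNorm _).trans ?_
      gcongr
      exact hdist s) (M.kappa αp βp 0)⁻¹ (WithLp.toLp 2 (M.kappa αp βp)) t
  rw [limitMap_path, limitMap_path, edist_dist, dist_eq_norm]
  calc ENNReal.ofReal ‖M.limitPath αp βp Z₀ (fun t f => CadlagSpace.path f t) t f -
        M.limitPath αp βp Z₀ (fun t f => CadlagSpace.path f t) t g‖
      ≤ ENNReal.ofReal (K * (edist f g).toReal) := by
        apply ENNReal.ofReal_le_ofReal
        refine h.trans (le_of_eq ?_)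
        simp only [K]
        ring
    _ = ENNReal.ofReal K * edist f g := by
      rw [ENNReal.ofReal_mul hK, ENNReal.ofReal_toReal htop]
    _ ≤ _ := by
      gcongr
      rw [ENNReal.ofReal]
      exact_mod_cast le_self_add

variable {M αp βp Z₀}

/-! ### The limit process -/

/-- If Y₀ were negative, the equation of the common trends could be solved for π⁻ in the column
space of Π^x; then Π⁻ would have rank at most r. -/
theorem zero_le_of_mem_commonTrends (hrx : M.PiX.rank = r) (hneg : (M.PiMat .neg).rank = r + 1)
    (h : Z₀ ∈ M.commonTrends) : 0 ≤ Z₀ 0 := by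
  by_contra hcon
  push Not at hcon
  have h1 : max (Z₀ 0) 0 • M.pi .pos + min (Z₀ 0) 0 • M.pi .neg +
      M.PiX *ᵥ (fun j => Z₀ j.succ) = 0 := h
  rw [max_eq_right hcon.le, min_eq_left hcon.le, zero_smul, zero_add] at h1
  let w : Fin d → ℝ := (-(Z₀ 0)⁻¹) • fun j => Z₀ j.succ
  have h2 : M.pi .neg = M.PiX *ᵥ w := by
    rw [Matrix.mulVec_smul, eq_neg_of_add_eq_zero_right h1, neg_smul, smul_neg, neg_neg, smul_smul,
      inv_mul_cancel₀ hcon.ne, one_smul]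
  have h3 : M.PiMat .neg = M.PiX * colCons w 1 := by
    ext a b
    rw [PiMat, h2, Matrix.mul_apply]
    refine Fin.cases ?_ (fun b => ?_) b
    · simp [colCons, Matrix.mulVec, dotProduct]
    · simp [colCons, Matrix.one_apply]
  have h4 := Matrix.rank_mul_le_left M.PiX (colCons w (1 : Matrix (Fin d) (Fin d) ℝ))
  rw [← h3, hneg, hrx] at h4
  omega

theorem betaT_mulVec_eq_zero (hαβ : M.PiMat .pos = α * βᵀ) (hα : α.rank = r) (h0 : 0 ≤ Z₀ 0)
    (h : Z₀ ∈ M.commonTrends) : βᵀ *ᵥ Z₀.ofLp = 0 := by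
  have h1 : max (Z₀ 0) 0 • M.pi .pos + min (Z₀ 0) 0 • M.pi .neg +
      M.PiX *ᵥ (fun j => Z₀ j.succ) = 0 := h
  rw [max_eq_left h0, min_eq_right h0, zero_smul, add_zero] at h1
  have h2 : M.PiMat .pos *ᵥ Z₀.ofLp = 0 := by
    rw [PiMat, colCons_mulVec]
    exact h1
  rw [hαβ, ← Matrix.mulVec_mulVec] at h2
  apply mulVec_injective_of_rank hα
  rw [h2, Matrix.mulVec_zero]

theorem limitPath_zero {Ω' : Type*} {U : I → Ω' → EuclideanSpace ℝ (Fin (d + 1))}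
    (hκ : M.kappa αp βp 0 ≠ 0) (t : I) (ω : Ω') :
    M.limitPath αp βp Z₀ U t ω 0 = M.projU αp βp Z₀ U t ω 0 +
      regulator (fun s => M.projU αp βp Z₀ U s ω 0) t := by
  simp only [limitPath, PiLp.add_apply, PiLp.smul_apply, smul_eq_mul]
  congr 1
  field_simp

variable {Ω' : Type*} [MeasurableSpace Ω'] {P' : Measure Ω'}
  {U : I → Ω' → EuclideanSpace ℝ (Fin (d + 1))} {S : Matrix (Fin (d + 1)) (Fin (d + 1)) ℝ}

/-- As PΓ⁺(1) fixes Z₀, the process is Y₀ plus the inner product of U with the first row a of P, so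
its variance is aᵀSa. -/
theorem isScalarBrownianMotion_projU (hU : IsBrownianMotion U S P') (hS : S.PosSemidef)
    (hfix : M.proj αp βp *ᵥ M.GammaOne .pos *ᵥ Z₀.ofLp = Z₀.ofLp) :
    IsScalarBrownianMotion (fun t ω => M.projU αp βp Z₀ U t ω 0) (Z₀ 0)
      (M.proj αp βp 0 ⬝ᵥ S *ᵥ M.proj αp βp 0).toNNReal P' := by
  let a : EuclideanSpace ℝ (Fin (d + 1)) := WithLp.toLp 2 (M.proj αp βp 0)
  have hW : ∀ t ω, M.projU αp βp Z₀ U t ω 0 = Z₀ 0 + innerSL ℝ a (U t ω) := by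
    intro t ω
    have h1 : M.projU αp βp Z₀ U t ω 0 =
        (M.proj αp βp *ᵥ (M.GammaOne .pos *ᵥ Z₀.ofLp + (U t ω).ofLp)) 0 := rfl
    rw [h1, Matrix.mulVec_add, hfix, Pi.add_apply]
    congr 1
    simp [a, PiLp.inner_apply, Matrix.mulVec, dotProduct, mul_comm]
  have hdiff : ∀ s t ω, M.projU αp βp Z₀ U t ω 0 - M.projU αp βp Z₀ U s ω 0 =
      innerSL ℝ a (U t ω - U s ω) := by
    intro s t ω
    rw [hW, hW, map_sub]
    ring
  refine ⟨?_, ?_, ?_, ?_⟩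
  · filter_upwards [hU.start] with ω hω
    rw [hW, hω, map_zero, add_zero]
  · have h1 := hU.indep.map (innerSL ℝ a)
    intro n t ht
    have h2 := h1 n t ht
    simp only [← map_sub] at h2
    simp only [hdiff]
    exact h2
  · intro s t hst
    simp only [hdiff]
    have hst' : 0 ≤ (t : ℝ) - s := sub_nonneg.2 hst
    have h1 := map_dotProduct_multivariateGaussian (hS.smul hst') a
    have h2 := hU.law s t hst
    refine ⟨(innerSL ℝ a).measurable.comp_aemeasurable h2.aemeasurable, ?_⟩
    have h3 : (fun ω => innerSL ℝ a (U t ω - U s ω)) =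
        (innerSL ℝ a) ∘ fun ω => U t ω - U s ω := rfl
    rw [h3, ← AEMeasurable.map_map_of_aemeasurable (innerSL ℝ a).measurable.aemeasurable
      h2.aemeasurable, h2.map_eq, h1]
    congr 1
    rw [Matrix.smul_mulVec, dotProduct_smul, smul_eq_mul, Real.toNNReal_mul hst']
  · filter_upwards [hU.cont] with ω hω
    simp only [hW]
    fun_prop

theorem isRegulatedBrownianMotion_limitPath (hU : IsBrownianMotion U S P') (hS : S.PosDef)
    (hκ : M.kappa αp βp 0 ≠ 0) (h0 : 0 ≤ Z₀ 0)
    (hfix : M.proj αp βp *ᵥ M.GammaOne .pos *ᵥ Z₀.ofLp = Z₀.ofLp) :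
    IsRegulatedBrownianMotion (fun t ω => M.limitPath αp βp Z₀ U t ω 0) (Z₀ 0) P' := by
  refine ⟨h0, _, _, ?_, isScalarBrownianMotion_projU hU hS.posSemidef hfix,
    ae_of_all _ fun ω t => limitPath_zero hκ t ω⟩
  rw [Real.toNNReal_pos]
  -- κ₁ is the product of this row with π⁻, so the row cannot vanish.
  have ha : M.proj αp βp 0 ≠ 0 := by
    intro h
    apply hκ
    rw [kappa, Matrix.mulVec, h, zero_dotProduct]
  simpa using hS.dotProduct_mulVec_pos ha

end CKSVAR

/-! ### From pathwise bounds to limits in probability and in distribution. -/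

theorem coe_sup_nnnorm_le {ι E : Type*} [NormedAddCommGroup E] {T : Finset ι} {f : ι → E} {b : ℝ}
    (hb : 0 ≤ b) (h : ∀ i ∈ T, ‖f i‖ ≤ b) : ((T.sup fun i => ‖f i‖₊ : ℝ≥0) : ℝ) ≤ b := by
  have h1 : (T.sup fun i => ‖f i‖₊) ≤ b.toNNReal :=
    Finset.sup_le fun i hi => by
      rw [Real.le_toNNReal_iff_coe_le hb]
      exact h i hi
  rwa [Real.le_toNNReal_iff_coe_le hb] at h1

theorem norm_le_coe_sup_nnnorm {ι E : Type*} [NormedAddCommGroup E] {T : Finset ι} {f : ι → E}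
    {i : ι} (hi : i ∈ T) : ‖f i‖ ≤ ((T.sup fun i => ‖f i‖₊ : ℝ≥0) : ℝ) := by
  have h1 := Finset.le_sup (f := fun i => ‖f i‖₊) hi
  exact_mod_cast h1

namespace CKSVAR

variable {d l : ℕ} {M : CKSVAR d l} {r q : ℕ} {α β : Matrix (Fin (d + 1)) (Fin r) ℝ}
  {αp βp : Matrix (Fin (d + 1)) (Fin q) ℝ} {Z₀ : EuclideanSpace ℝ (Fin (d + 1))}
  {Ω : Type*}
  {u : ℕ → Ω → EuclideanSpace ℝ (Fin (d + 1))}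
  {z : ℕ → ℤ → Ω → EuclideanSpace ℝ (Fin (d + 1))}

theorem IsGenerated.isPath {z : ℤ → Ω → EuclideanSpace ℝ (Fin (d + 1))} (h : M.IsGenerated u z)
    (ω : Ω) : M.IsPath (fun t => (u t ω).ofLp) (fun t => (z t ω).ofLp) :=
  fun t ht => congrArg WithLp.ofLp (h t ht ω)

theorem IsGenerated.aemeasurable [MeasurableSpace Ω] {P : Measure Ω}
    {z : ℤ → Ω → EuclideanSpace ℝ (Fin (d + 1))} (h : M.IsGenerated u z)
    (hu : ∀ t, 1 ≤ t → AEMeasurable (u t) P)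
    (hz : ∀ t : ℤ, -(l + 1 : ℤ) ≤ t → t ≤ 0 → AEMeasurable (z t) P) (t : ℕ) :
    AEMeasurable (z t) P := by
  have key : ∀ n : ℕ, ∀ t : ℤ, -(l + 1 : ℤ) ≤ t → t ≤ n → AEMeasurable (z t) P := by
    intro n
    induction n with
    | zero => exact fun t h1 h2 => hz t h1 (by simpa using h2)
    | succ n ih =>
      intro t h1 h2
      rcases lt_or_eq_of_le h2 with h3 | h3
      · exact ih t h1 (by push_cast at h3; omega)
      · subst h3
        have h4 := h (n + 1) (by omega)
        have h5 : z ((n + 1 : ℕ) : ℤ) = fun ω => WithLp.toLp 2 (M.c +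
            ∑ i ∈ Finset.Icc 1 (l + 2), (max (z ((n + 1 : ℕ) - i) ω 0) 0 • M.phi .pos i +
            min (z ((n + 1 : ℕ) - i) ω 0) 0 • M.phi .neg i
            + M.PhiX i *ᵥ (fun j => z ((n + 1 : ℕ) - i) ω j.succ))) + u (n + 1) ω :=
          funext h4
        rw [h5]
        refine AEMeasurable.add ?_ (hu (n + 1) (by omega))
        have hsum : AEMeasurable (fun ω => ∑ i ∈ Finset.Icc 1 (l + 2),
            (max (z ((n + 1 : ℕ) - i) ω 0) 0 • M.phi .pos i +
            min (z ((n + 1 : ℕ) - i) ω 0) 0 • M.phi .neg i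
            + M.PhiX i *ᵥ (fun j => z ((n + 1 : ℕ) - i) ω j.succ))) P := by
          refine Finset.aemeasurable_fun_sum _ fun i hi => ?_
          have hi' := Finset.mem_Icc.1 hi
          have h6 := ih ((n + 1 : ℕ) - i) (by omega) (by push_cast; omega)
          have h7 : Continuous fun x : EuclideanSpace ℝ (Fin (d + 1)) =>
              max (x 0) 0 • M.phi .pos i + min (x 0) 0 • M.phi .neg i
                + M.PhiX i *ᵥ (fun j => x j.succ) := by
            refine ((by fun_prop : Continuous _).add (by fun_prop)).add ?_
            exact continuous_const.matrix_mulVec (by fun_prop)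
          exact h7.measurable.comp_aemeasurable h6
        exact (PiLp.continuous_toLp 2 _).measurable.comp_aemeasurable (hsum.const_add M.c)
  exact key t t (by omega) le_rfl

/-- A bound for the shocks up to time `n` and for the short-memory components of the initial
values. -/
def inputSize (l : ℕ) (β : Matrix (Fin (d + 1)) (Fin r) ℝ)
    (u : ℕ → Ω → EuclideanSpace ℝ (Fin (d + 1)))
    (z : ℕ → ℤ → Ω → EuclideanSpace ℝ (Fin (d + 1))) (n : ℕ) (ω : Ω) : ℝ :=
  1 + ((Finset.Icc 1 n).sup fun t => ‖u t ω‖₊ : ℝ≥0) +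
    ((({n} : Finset ℕ) ×ˢ Finset.Icc (-(l + 1 : ℤ)) 0).sup
      fun i => ‖act βᵀ (z i.1 i.2 ω)‖₊ : ℝ≥0) +
    ((({n} : Finset ℕ) ×ˢ Finset.Icc (-(l : ℤ)) 0).sup
      fun i => ‖z i.1 i.2 ω - z i.1 (i.2 - 1) ω‖₊ : ℝ≥0) +
    ((({n} : Finset ℕ) ×ˢ Finset.Icc (-(l + 1 : ℤ)) 0).sup
      fun i => ‖min (z i.1 i.2 ω 0) 0‖₊ : ℝ≥0)

theorem inputBound_inputSize (n : ℕ) (ω : Ω) :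
    InputBound l β (fun t => (u t ω).ofLp) (fun t => (z n t ω).ofLp) n
      (inputSize l β u z n ω) := by
  have h1 := NNReal.coe_nonneg ((Finset.Icc 1 n).sup fun t => ‖u t ω‖₊)
  have h2 := NNReal.coe_nonneg ((({n} : Finset ℕ) ×ˢ Finset.Icc (-(l + 1 : ℤ)) 0).sup
      fun i => ‖act βᵀ (z i.1 i.2 ω)‖₊)
  have h3 := NNReal.coe_nonneg ((({n} : Finset ℕ) ×ˢ Finset.Icc (-(l : ℤ)) 0).sup
      fun i => ‖z i.1 i.2 ω - z i.1 (i.2 - 1) ω‖₊)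
  have h4 := NNReal.coe_nonneg ((({n} : Finset ℕ) ×ˢ Finset.Icc (-(l + 1 : ℤ)) 0).sup
      fun i => ‖min (z i.1 i.2 ω 0) 0‖₊)
  refine ⟨?_, fun t h h' => ?_, ?_, fun t h h' => ?_, fun t h h' => ?_⟩
  · simp only [inputSize]; linarith
  · refine (norm_ofLp_le _).trans ?_
    have h5 := norm_le_coe_sup_nnnorm (T := Finset.Icc 1 n) (f := fun t => u t ω)
      (Finset.mem_Icc.2 ⟨h, h'⟩)
    simp only [inputSize]; linarith
  · have h5 := norm_le_coe_sup_nnnorm (T := ({n} : Finset ℕ) ×ˢ Finset.Icc (-(l + 1 : ℤ)) 0)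
      (f := fun i => act βᵀ (z i.1 i.2 ω)) (i := (n, 0)) (by simp)
    refine (norm_ofLp_le (act βᵀ (z n 0 ω))).trans ?_
    simp only [inputSize]; linarith
  · have h5 := norm_le_coe_sup_nnnorm (T := ({n} : Finset ℕ) ×ˢ Finset.Icc (-(l : ℤ)) 0)
      (f := fun i => z i.1 i.2 ω - z i.1 (i.2 - 1) ω) (i := (n, t)) (by simp; omega)
    refine (norm_ofLp_le (z n t ω - z n (t - 1) ω)).trans ?_
    simp only [inputSize]; linarith
  · have h5 := norm_le_coe_sup_nnnorm (T := ({n} : Finset ℕ) ×ˢ Finset.Icc (-(l + 1 : ℤ)) 0)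
      (f := fun i => min (z i.1 i.2 ω 0) 0) (i := (n, t)) (by simp; omega)
    rw [Real.norm_eq_abs] at h5
    simp only [inputSize]; linarith

theorem vanishes_inputSize [MeasurableSpace Ω] {P : Measure Ω} {δ : ℝ} (hδ : 0 < δ)
    (hu : BoundedMoments u {t | 1 ≤ t} (2 + δ) P) (hinit : InitialCondition M P β δ z Z₀) :
    Vanishes P (fun n ω => (√(n : ℝ))⁻¹ * inputSize l β u z n ω) := by
  have h0 : Vanishes P (fun n _ => (√(n : ℝ))⁻¹) := vanishes_of_tendsto
    (tendsto_inv_atTop_zero.comp (Real.tendsto_sqrt_atTop.comp tendsto_natCast_atTop_atTop))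
  have h1 := hu.vanishes_sup hδ (fun n => Finset.Icc 1 n)
    (fun n i hi => (Finset.mem_Icc.1 hi).1) 0 (fun n => by simp)
  have h2 := hinit.moments_eqErr.vanishes_sup hδ
    (fun n => ({n} : Finset ℕ) ×ˢ Finset.Icc (-(l + 1 : ℤ)) 0)
    (fun n i hi => Finset.mem_Icc.1 (Finset.mem_product.1 hi).2) (l + 2)
    (fun n => by simp; omega)
  have h3 := hinit.moments_diff.vanishes_sup hδ
    (fun n => ({n} : Finset ℕ) ×ˢ Finset.Icc (-(l : ℤ)) 0)
    (fun n i hi => Finset.mem_Icc.1 (Finset.mem_product.1 hi).2) (l + 2)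
    (fun n => by simp; omega)
  have h4 := hinit.moments_neg.vanishes_sup hδ
    (fun n => ({n} : Finset ℕ) ×ˢ Finset.Icc (-(l + 1 : ℤ)) 0)
    (fun n i hi => Finset.mem_Icc.1 (Finset.mem_product.1 hi).2) (l + 2)
    (fun n => by simp; omega)
  refine ((((h0.add h1).add h2).add h3).add h4).mono fun n ω => le_of_eq ?_
  simp only [inputSize]
  ring

theorem isStarStationary_of_norm_le [MeasurableSpace Ω] {P : Measure Ω} {E : Type*}
    [NormedAddCommGroup E] {w : ℕ → ℕ → Ω → E} {B : ℕ → Ω → ℝ} {C : ℝ} (hC : 0 ≤ C)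
    (hB0 : ∀ n ω, 0 ≤ B n ω) (hB : Vanishes P fun n ω => (√(n : ℝ))⁻¹ * B n ω)
    (h : ∀ n ω t, 1 ≤ t → t ≤ n → ‖w n t ω‖ ≤ C * B n ω) : IsStarStationary w P := by
  refine Vanishes.tendstoInMeasure ((hB.const_mul hC).mono fun n ω => ?_)
    fun n ω => by positivity
  rw [mul_left_comm]
  refine mul_le_mul_of_nonneg_left ?_ (by positivity)
  exact coe_sup_nnnorm_le (mul_nonneg hC (hB0 n ω)) fun t ht =>
    h n ω t (Finset.mem_Icc.1 ht).1 (Finset.mem_Icc.1 ht).2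

/-- A time of the grid of mesh `1 / n`. -/
theorem exists_floor_mul_eq {n : ℕ} (hn : 0 < n) {m : ℕ} {t : I} (hm : m ≤ ⌊n * (t : ℝ)⌋₊) :
    ∃ s : I, s ≤ t ∧ ⌊n * (s : ℝ)⌋₊ = m := by
  have hn' : (0 : ℝ) < n := by exact_mod_cast hn
  have h1 : (m : ℝ) ≤ n * t := (Nat.le_floor_iff (mul_nonneg hn'.le t.2.1)).1 hm
  have h2 : (m : ℝ) / n ≤ t := by rwa [div_le_iff₀' hn']
  refine ⟨⟨m / n, by positivity, h2.trans t.2.2⟩, h2, ?_⟩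
  simp only
  rw [mul_div_cancel₀ _ hn'.ne', Nat.floor_natCast]

/-- Along each path, the rescaled process is close to the image of the rescaled partial sums. -/
theorem exists_norm_sub_limitPath_le (hαβ : M.PiMat .pos = α * βᵀ) (hβ : β.rank = r)
    (hjsr : jointSpectralRadius {M.F α β 0, M.F α β 1} < 1)
    (hαp : IsOrthocomplement α αp) (hβp : IsOrthocomplement β βp) (hκ : M.kappa αp βp 0 < 0)
    (hc : ∃ v, M.PiMat .pos *ᵥ v = M.c) (Z₀ : EuclideanSpace ℝ (Fin (d + 1))) :
    ∃ C : ℝ, 0 ≤ C ∧ ∀ (u : ℕ → EuclideanSpace ℝ (Fin (d + 1)))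
      (z : ℤ → EuclideanSpace ℝ (Fin (d + 1))) (n : ℕ) (B : ℝ), 0 < n →
      M.IsPath (fun t => (u t).ofLp) (fun t => (z t).ofLp) →
      InputBound l β (fun t => (u t).ofLp) (fun t => (z t).ofLp) n B →
      ∀ (f : CadlagSpace (EuclideanSpace ℝ (Fin (d + 1)))),
      (∀ t, f.path t = (√(n : ℝ))⁻¹ • ∑ i ∈ Finset.Icc 1 ⌊n * (t : ℝ)⌋₊, u i) → ∀ t : I,
      ‖(√(n : ℝ))⁻¹ • z (⌊n * (t : ℝ)⌋₊ : ℕ) - (M.limitMap αp βp Z₀ f).path t‖ ≤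
        C * ((√(n : ℝ))⁻¹ * B + ‖(√(n : ℝ))⁻¹ • z 0 - Z₀‖) := by
  obtain ⟨C₁, hC₁, h₁⟩ := exists_pathwise_bound hαβ hβ hjsr hαp hβp hκ hc
  obtain ⟨C₂, hC₂, h₂⟩ := exists_norm_toLp_le (Fin (d + 1))
  let k : EuclideanSpace ℝ (Fin (d + 1)) := WithLp.toLp 2 (M.kappa αp βp)
  let c : ℝ := (M.kappa αp βp 0)⁻¹
  let C₃ : ℝ := ‖actL (M.proj αp βp)‖ * ‖actL (M.GammaOne .pos)‖
  refine ⟨C₂ * C₁ + |c| * C₁ * ‖k‖ + (1 + |c| * ‖k‖) * C₃, by positivity, ?_⟩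
  intro u z n B hn hz hB f hf t
  obtain ⟨-, hpath⟩ := h₁ _ _ n B hz hB
  have hB0 : 0 ≤ B := zero_le_one.trans hB.one_le
  set a : ℝ := (√(n : ℝ))⁻¹ with ha
  have ha0 : 0 ≤ a := by positivity
  let tr : ℕ → EuclideanSpace ℝ (Fin (d + 1)) := fun m => WithLp.toLp 2
    (M.trend αp βp (fun t => (u t).ofLp) (z 0).ofLp m)
  have htr : ∀ m, tr m = actL (M.proj αp βp) (actL (M.GammaOne .pos) (z 0) +
      ∑ i ∈ Finset.Icc 1 m, u i) := by
    intro m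
    simp [tr, actL_apply, act, trend]
  -- v is the rescaled trend started from the actual z₀, while v' is the same trend started from Z₀;
  -- they differ only by the image of the initial error.
  let v : I → EuclideanSpace ℝ (Fin (d + 1)) := fun s => a • tr ⌊n * (s : ℝ)⌋₊
  let v' : I → EuclideanSpace ℝ (Fin (d + 1)) := fun s =>
    M.projU αp βp Z₀ (fun t f => CadlagSpace.path f t) s f
  have hvv' : ∀ s, ‖v s - v' s‖ ≤ C₃ * ‖a • z 0 - Z₀‖ := by
    intro s
    have h3 : v s - v' s = actL (M.proj αp βp) (actL (M.GammaOne .pos) (a • z 0 - Z₀)) := by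
      simp only [v, v', projU, htr, hf, ← actL_apply, map_add, map_sub, map_smul, smul_add]
      abel
    rw [h3]
    calc ‖actL (M.proj αp βp) (actL (M.GammaOne .pos) (a • z 0 - Z₀))‖
        ≤ ‖actL (M.proj αp βp)‖ * (‖actL (M.GammaOne .pos)‖ * ‖a • z 0 - Z₀‖) :=
          ((actL (M.proj αp βp)).le_opNorm _).trans (by
            gcongr
            exact (actL (M.GammaOne .pos)).le_opNorm _)
      _ = C₃ * ‖a • z 0 - Z₀‖ := by simp only [C₃]; ring
  obtain ⟨D, hD⟩ := (isCadlag_step (fun m => (a • tr m) 0) n).exists_abs_le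
  have hD' : ∀ s, |v s 0| ≤ D := hD
  obtain ⟨D', hD''⟩ := (M.isCadlag_projU_zero αp βp Z₀ f).exists_abs_le
  have hreg := norm_regulated_sub_le hD' hD'' hvv' c k t
  obtain ⟨ℓ, hz', hup, m, hm, hlow⟩ := hpath ⌊n * (t : ℝ)⌋₊ (floor_mul_le n t)
  have hv0 : ∀ s, max (-v s 0) 0 =
      a * max (-(M.trend αp βp (fun t => (u t).ofLp) (z 0).ofLp ⌊n * (s : ℝ)⌋₊ 0)) 0 := by
    intro s
    rw [mul_max_of_nonneg _ _ ha0, mul_zero, mul_neg]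
    rfl
  have hreg' : |a * ℓ - regulator (fun s => v s 0) t| ≤ a * (C₁ * B) := by
    rw [abs_le]
    constructor
    · have h3 : regulator (fun s => v s 0) t ≤ a * ℓ + a * (C₁ * B) := by
        refine regulator_le fun s hs => ?_
        rw [hv0, ← mul_add]
        refine mul_le_mul_of_nonneg_left (hup _ ?_) ha0
        refine Nat.floor_le_floor ?_
        have : (s : ℝ) ≤ t := hs
        gcongr
      linarith
    -- The discrete witness is realised at a grid time s ≤ t, so the continuous-time supremum sees
    -- it.
    · obtain ⟨s, hst, rfl⟩ := exists_floor_mul_eq hn hm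
      have h3 := le_regulator hD' hst
      rw [hv0] at h3
      have h4 := mul_le_mul_of_nonneg_left hlow ha0
      rw [mul_add] at h4
      linarith
  have hmain : ‖a • z (⌊n * (t : ℝ)⌋₊ : ℕ) - (v t + (c * (a * ℓ)) • k)‖ ≤ a * (C₂ * (C₁ * B)) := by
    have h3 : a • z (⌊n * (t : ℝ)⌋₊ : ℕ) - (v t + (c * (a * ℓ)) • k) =
        a • (WithLp.toLp 2 ((z (⌊n * (t : ℝ)⌋₊ : ℕ)).ofLp -
          M.trend αp βp (fun t => (u t).ofLp) (z 0).ofLp ⌊n * (t : ℝ)⌋₊ -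
          (c * ℓ) • M.kappa αp βp) : EuclideanSpace ℝ (Fin (d + 1))) := by
      simp only [v, tr, k, WithLp.toLp_sub, WithLp.toLp_smul, WithLp.toLp_ofLp]
      module
    rw [h3, norm_smul, Real.norm_of_nonneg ha0]
    refine mul_le_mul_of_nonneg_left ((h₂ _).trans ?_) ha0
    exact mul_le_mul_of_nonneg_left hz' hC₂
  have hdiff : ‖(v t + (c * (a * ℓ)) • k) - (v t + (c * regulator (fun s => v s 0) t) • k)‖ ≤
      |c| * (a * (C₁ * B)) * ‖k‖ := by
    rw [add_sub_add_left_eq_sub, ← sub_smul, ← mul_sub, norm_smul, Real.norm_eq_abs, abs_mul]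
    gcongr
  have hfinal : (M.limitMap αp βp Z₀ f).path t =
      v' t + (c * regulator (fun s => v' s 0) t) • k := rfl
  rw [hfinal]
  -- Three errors: the pathwise approximation of z, the replacement of ℓ by the regulator, and the
  -- replacement of the initial value by its limit.
  have htri : a • z (⌊n * (t : ℝ)⌋₊ : ℕ) - (v' t + (c * regulator (fun s => v' s 0) t) • k) =
      (a • z (⌊n * (t : ℝ)⌋₊ : ℕ) - (v t + (c * (a * ℓ)) • k)) +
      ((v t + (c * (a * ℓ)) • k) - (v t + (c * regulator (fun s => v s 0) t) • k)) +
      ((v t + (c * regulator (fun s => v s 0) t) • k) -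
        (v' t + (c * regulator (fun s => v' s 0) t) • k)) := by abel
  rw [htri]
  refine (norm_add₃_le).trans ((add_le_add (add_le_add hmain hdiff) hreg).trans ?_)
  have hN := norm_nonneg (a • z 0 - Z₀)
  have hP : 0 ≤ a * B := by positivity
  have hx : 0 ≤ C₂ * C₁ + |c| * C₁ * ‖k‖ := by positivity
  have hy : 0 ≤ (1 + |c| * ‖k‖) * C₃ := by positivity
  calc a * (C₂ * (C₁ * B)) + |c| * (a * (C₁ * B)) * ‖k‖ +
        (1 + |c| * ‖k‖) * (C₃ * ‖a • z 0 - Z₀‖)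
      = (C₂ * C₁ + |c| * C₁ * ‖k‖) * (a * B) + (1 + |c| * ‖k‖) * C₃ * ‖a • z 0 - Z₀‖ := by ring
    _ ≤ (C₂ * C₁ + |c| * C₁ * ‖k‖ + (1 + |c| * ‖k‖) * C₃) * (a * B + ‖a • z 0 - Z₀‖) := by
      rw [mul_add]
      refine add_le_add ?_ ?_
      · exact mul_le_mul_of_nonneg_right (by linarith) hP
      · exact mul_le_mul_of_nonneg_right (by linarith) hN

end CKSVAR

end

end RegCoint

/-! ### The theorem. -/

theorem theorem1 {d l : ℕ} (M : RegCoint.CKSVAR d l)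
    {Ω : Type*} [MeasurableSpace Ω] (P : Measure Ω) [IsProbabilityMeasure P]
    {Ω' : Type*} [MeasurableSpace Ω'] (P' : Measure Ω') [IsProbabilityMeasure P']
    (u : ℕ → Ω → EuclideanSpace ℝ (Fin (d + 1)))
    (z : ℕ → ℤ → Ω → EuclideanSpace ℝ (Fin (d + 1)))
    (hz : ∀ n, M.IsGenerated u (z n))
    (δ : ℝ) (U : unitInterval → Ω' → EuclideanSpace ℝ (Fin (d + 1)))
    (S : Matrix (Fin (d + 1)) (Fin (d + 1)) ℝ)
    (herr : RegCoint.ErrorCondition P P' u δ U S)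
    (q rk : RegCoint.Regime → ℕ) (hroots : M.HasUnitRoots q rk)
    (r : ℕ) (hrpos : rk .pos = r) (hrneg : rk .neg = r + 1) (hrx : M.PiX.rank = r)
    (α β : Matrix (Fin (d + 1)) (Fin r) ℝ) (hα : α.rank = r) (hβ : β.rank = r)
    (hαβ : M.PiMat .pos = α * βᵀ)
    (hjsr : RegCoint.jointSpectralRadius {M.F α β 0, M.F α β 1} < 1)
    (αp βp : Matrix (Fin (d + 1)) (Fin (q .pos)) ℝ)
    (hαp : RegCoint.IsOrthocomplement α αp) (hβp : RegCoint.IsOrthocomplement β βp)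
    (hκ : M.kappa αp βp 0 < 0)
    (Z₀ : EuclideanSpace ℝ (Fin (d + 1)))
    (hinit : RegCoint.InitialCondition M P β δ z Z₀) :
    (RegCoint.IsStarStationary (fun n t ω => RegCoint.act βᵀ (z n t ω)) P ∧
      RegCoint.IsStarStationary (fun n t ω => z n t ω - z n ((t : ℤ) - 1) ω) P ∧
      RegCoint.IsStarStationary (fun n t ω => min (z n t ω 0) 0) P) ∧
    RegCoint.ConvergesWeaklyOnD P P'
      (fun (n : ℕ) t ω => (√(n : ℝ))⁻¹ • z n (⌊n * (t : ℝ)⌋₊ : ℕ) ω)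
      (M.limitPath αp βp Z₀ U) ∧
    (∀ ω t, M.limitPath αp βp Z₀ U t ω 0 =
      M.projU αp βp Z₀ U t ω 0 +
        RegCoint.regulator (fun s => M.projU αp βp Z₀ U s ω 0) t) ∧
    RegCoint.IsRegulatedBrownianMotion (fun t ω => M.limitPath αp βp Z₀ U t ω 0) (Z₀ 0) P' := by
  have hκ0 : M.kappa αp βp 0 ≠ 0 := hκ.ne
  have hc := hroots.intercept .pos
  have hmom := herr.moments
  have hneg : (M.PiMat .neg).rank = r + 1 := (hroots.rank_eq .neg).trans hrneg
  have hZ0 : 0 ≤ Z₀ 0 := RegCoint.CKSVAR.zero_le_of_mem_commonTrends hrx hneg hinit.mem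
  have hfix := RegCoint.CKSVAR.proj_mulVec_gammaOne_mulVec (αp := αp) hκ0 hβ hβp
    (RegCoint.CKSVAR.betaT_mulVec_eq_zero hαβ hα hZ0 hinit.mem)
  have hvan := RegCoint.CKSVAR.vanishes_inputSize herr.delta_pos hmom hinit
  have hinput := fun n ω => RegCoint.CKSVAR.inputBound_inputSize (l := l) (β := β) (u := u)
    (z := z) n ω
  have hB0 : ∀ n ω, 0 ≤ RegCoint.CKSVAR.inputSize l β u z n ω := fun n ω =>
    zero_le_one.trans (hinput n ω).one_le
  refine ⟨?_, ?_, fun ω t => RegCoint.CKSVAR.limitPath_zero hκ0 t ω,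
    RegCoint.CKSVAR.isRegulatedBrownianMotion_limitPath herr.brownian herr.posDef hκ0 hZ0 hfix⟩
  · obtain ⟨C, hC, h⟩ := RegCoint.CKSVAR.exists_shortMemoryBound hαβ hjsr
    have hb := fun n ω => h _ _ n _ ((hz n).isPath ω) (hinput n ω)
    obtain ⟨C₁, hC₁, h₁⟩ := RegCoint.exists_norm_toLp_le (Fin r)
    obtain ⟨C₂, hC₂, h₂⟩ := RegCoint.exists_norm_toLp_le (Fin (d + 1))
    refine ⟨RegCoint.CKSVAR.isStarStationary_of_norm_le (mul_nonneg hC₁ hC) hB0 hvan ?_,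
      RegCoint.CKSVAR.isStarStationary_of_norm_le (mul_nonneg hC₂ hC) hB0 hvan ?_,
      RegCoint.CKSVAR.isStarStationary_of_norm_le hC hB0 hvan ?_⟩
    · intro n ω t _ ht'
      rw [mul_assoc]
      exact (h₁ _).trans (mul_le_mul_of_nonneg_left ((hb n ω).eqErr t ht') hC₁)
    · intro n ω t _ ht'
      rw [mul_assoc]
      exact (h₂ (z n t ω - z n ((t : ℤ) - 1) ω).ofLp).trans (mul_le_mul_of_nonneg_left
        ((hb n ω).diff t (by omega) (by exact_mod_cast ht')) hC₂)
    · intro n ω t _ ht'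
      exact (hb n ω).neg t (by omega) (by exact_mod_cast ht')
  · obtain ⟨X', U', hX', hU', hconv⟩ := herr.partialSums
    obtain ⟨C, hC, h⟩ :=
      RegCoint.CKSVAR.exists_norm_sub_limitPath_le hαβ hβ hjsr hαp hβp hκ hc Z₀
    have hmeas : ∀ n (t : ℕ), AEMeasurable (z n t) P := fun n t =>
      (hz n).aemeasurable (fun t ht => (hmom.1 t ht).aemeasurable) (hinit.measurable n) t
    refine ⟨fun n ω => RegCoint.stepFun n fun i => (√(n : ℝ))⁻¹ • z n (i : ℕ) ω,
      M.limitMap αp βp Z₀ ∘ U', fun n => ae_of_all _ fun ω t => rfl, ?_, ?_⟩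
    · filter_upwards [hU'] with ω hω t
      simp only [Function.comp_apply, RegCoint.CKSVAR.limitMap_path, RegCoint.CKSVAR.limitPath,
        RegCoint.CKSVAR.projU, hω]
    -- Continuous mapping handles `limitMap` of the partial sums; the rescaled process lies
    -- uniformly within a multiple of n^(-1/2)B + ‖n^(-1/2)z₀ - Z₀‖ of it, and this vanishes in
    -- probability.
    · refine RegCoint.tendstoInDistribution_of_vanishes
        (hconv.continuous_comp (M.continuous_limitMap αp βp Z₀)) (fun n => ?_)
        ((hvan.add (RegCoint.vanishes_norm_sub hinit.tendsto)).const_mul hC) ?_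
      · refine (RegCoint.continuous_stepFun n).measurable.comp_aemeasurable ?_
        exact aemeasurable_pi_lambda _ fun i => (hmeas n i).const_smul (√(n : ℝ))⁻¹
      · filter_upwards [eventually_gt_atTop 0] with n hn
        filter_upwards [hX' n] with ω hω
        rw [RegCoint.CadlagSpace.edist_le_iff]
        intro t
        rw [edist_dist, dist_eq_norm]
        exact ENNReal.ofReal_le_ofReal (h (fun t => u t ω) (fun t => z n t ω) n _ hn
          ((hz n).isPath ω) (hinput n ω) (X' n ω) hω t)
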